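/- Let $n\ge 1$. A (possibly unbounded) convex body in $\mathbb R^n$ is a closed convex set $W\subset\mathbb R^n$ with nonempty interior, and a convex hypersurface of $\mathbb R^n$ is the boundary $\partial W$ of such a set. A function $\varphi$ on an open set $D$ of a Euclidean space is of class $C^{1,1}$ if it is $C^1$ on $D$ and its derivative is Lipschitz on $D$. A set $S\subset\mathbb R^n$ is of class $C^{1,1}_{\rm loc}$ if it is locally a graph of a $C^{1,1}$ function: every $x\in S$ has an open neighbourhood $U$ for which there are a unit vector $e$, an open subset $D$ of the hyperplane $e^\perp$ and a $C^{1,1}$ function $\varphi:D\to\mathbb R$ with $S\cap U=\{h+\varphi(h)e:\ h\in D\}$. A line is a subset of $\mathbb R^n$ isometric to $\mathbb R$. Let $\mathcal H^{n-1}$ denote the $(n-1)$-dimensional Hausdorff measure and $A\triangle B=(A\setminus B)\cup(B\setminus A)$. (a) Let $S$ be a convex hypersurface of $\mathbb R^n$ that is not of class $C^{1,1}_{\rm loc}$. Then the following assertions are equivalent: 1. For every $\varepsilon>0$ there exists a convex hypersurface $S_\varepsilon$ of $\mathbb R^n$ of class $C^{1,1}_{\rm loc}$ such that $\mathcal H^{n-1}(S\triangle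 S_\varepsilon)<\varepsilon$. 2. $S$ does not contain any line. (b) If $W\subset\mathbb R^n$ is a (possibly unbounded) convex body that contains no line, then for every $\varepsilon>0$ there exists a (possibly unbounded) convex body $W_\varepsilon\subset W$ such that $\partial W_\varepsilon$ is of class $C^{1,1}_{\rm loc}$ and $\mathcal H^{n-1}(\partial W\triangle\partial W_\varepsilon)<\varepsilon$. -/

import Mathlib

open Set MeasureTheory
open scoped symmDiff

/-- A closed convex set with nonempty interior: a (possibly unbounded) convex body. -/
structure IsConvexBodyUnbdd {n : ℕ} (W : Set (EuclideanSpace ℝ (Fin n))) : Prop where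
  isClosed : IsClosed W
  convex : Convex ℝ W
  interior_nonempty : (interior W).Nonempty

/-- A convex hypersurface: the boundary of a (possibly unbounded) convex body. -/
def IsConvexHypersurface {n : ℕ} (S : Set (EuclideanSpace ℝ (Fin n))) : Prop :=
  ∃ W : Set (EuclideanSpace ℝ (Fin n)), IsConvexBodyUnbdd W ∧ S = frontier W

/-- `φ` is of class `C^{1,1}` on the open set `D`: it is `C¹` on `D` and its derivative is
Lipschitz on `D`. -/
def IsC11On {H : Type*} [NormedAddCommGroup H] [NormedSpace ℝ H] (φ : H → ℝ) (D : Set H) : Prop :=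
  IsOpen D ∧ ContDiffOn ℝ 1 φ D ∧ ∃ K : NNReal, LipschitzOnWith K (fderiv ℝ φ) D

/-- `S` is of class `C^{1,1}_loc`, that is, locally a graph of a `C^{1,1}` function: every point
of `S` has an open neighbourhood `U` such that `S ∩ U` is the graph, in the direction of some unit
vector `e`, of a `C^{1,1}` function on an open subset `D` of the hyperplane `e^⊥`. -/
def IsC11LocHypersurface {n : ℕ} (S : Set (EuclideanSpace ℝ (Fin n))) : Prop :=
  ∀ x ∈ S, ∃ U : Set (EuclideanSpace ℝ (Fin n)), IsOpen U ∧ x ∈ U ∧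
    ∃ e : EuclideanSpace ℝ (Fin n), ‖e‖ = 1 ∧
      ∃ (D : Set (Submodule.span ℝ {e})ᗮ) (φ : (Submodule.span ℝ {e})ᗮ → ℝ),
        IsC11On φ D ∧
          S ∩ U = (fun h : (Submodule.span ℝ {e})ᗮ => (h : EuclideanSpace ℝ (Fin n)) + φ h • e) '' D

/-- `A` contains a line, a line being a set isometric to `ℝ`. -/
def ContainsLine {n : ℕ} (A : Set (EuclideanSpace ℝ (Fin n))) : Prop :=
  ∃ γ : ℝ → EuclideanSpace ℝ (Fin n), Isometry γ ∧ range γ ⊆ A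

/-! The approximation is a union of closed balls inside `W`. If interior balls of radius at least
`r` touch the frontier, the Gauss map is `1/r`-Lipschitz, so locally uniform radii make the frontier
`C^{1,1}_loc` (`isC11LocHypersurface_frontier`). Conversely, convex functions have a quadratic upper
bound almost everywhere, so almost every point of `∂W` is touched by some interior ball
(`IsConvexBodyUnbdd.measure_not_touchedByBall`).

A line-free `W` has a nonnegative affine height with bounded sublevels. Each unit slab of heights
then meets `∂W` in finite measure, so one radius per slab suffices up to a small loss. Letting the
admissible radii decay with height through a convex constraint keeps the union convex and closed
(`roundedBody`). The new frontier costs no more than the lost one: moving along outer normals of the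
smaller body until leaving `W` does not decrease distances (`measure_frontier_diff_le`).

In the other direction, if `∂W` contains a line, it is a cylinder. A frontier differing from it by
finite measure meets nearly all far translates of a patch, hence shares the direction; two cylinders
with the same direction that differ somewhere differ by infinite measure
(`IsConvexBodyUnbdd.frontier_eq_of_measure_symmDiff_ne_top`). So only `S` itself could approximate
`S`, and `S` is not `C^{1,1}_loc`. -/

open Metric Filter Topology
open scoped InnerProductSpace

/-! ### Outer normals, touching balls and projection along a unit vector. -/

section ConvexGeometry

variable {E : Type*} [NormedAddCommGroup E] [InnerProductSpace ℝ E]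

/-- `ν` is an outer normal vector of `W` at `x`. -/
def IsNormalAt (W : Set E) (x ν : E) : Prop := ∀ q ∈ W, ⟪ν, q - x⟫_ℝ ≤ 0

/-- The point `x` lies in a closed ball of radius `ρ` contained in `W`. -/
def TouchedByBall (W : Set E) (ρ : ℝ) (x : E) : Prop :=
  ∃ c, closedBall c ρ ⊆ W ∧ x ∈ closedBall c ρ

/-- The normal inequality is tested at the point of the ball farthest in direction `ν`. -/
theorem IsNormalAt.inner_center_le {W : Set E} {x ν c : E} {δ : ℝ} (hν : IsNormalAt W x ν)
    (hδ : 0 ≤ δ) (hc : closedBall c δ ⊆ W) : ⟪ν, c - x⟫_ℝ ≤ -(δ * ‖ν‖) := by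
  rcases eq_or_ne ν 0 with rfl | h0
  · simp
  have hn : ‖ν‖ ≠ 0 := norm_ne_zero_iff.2 h0
  have hq : c + (δ / ‖ν‖) • ν ∈ W := by
    apply hc
    rw [mem_closedBall, dist_eq_norm, add_sub_cancel_left, norm_smul, Real.norm_eq_abs, abs_div,
      abs_norm, abs_of_nonneg hδ, div_mul_cancel₀ _ hn]
  have h := hν _ hq
  have he : c + (δ / ‖ν‖) • ν - x = (c - x) + (δ / ‖ν‖) • ν := by abel
  rw [he, inner_add_right, inner_smul_right, real_inner_self_eq_norm_sq] at h
  have : δ / ‖ν‖ * ‖ν‖ ^ 2 = δ * ‖ν‖ := by field_simp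
  linarith

/-- The centre of a ball in `W` touching a frontier point is found along the normal. -/
theorem IsNormalAt.center_eq {W : Set E} {x ν c : E} {ρ : ℝ} (hν : IsNormalAt W x ν)
    (h1 : ‖ν‖ = 1) (hρ : 0 ≤ ρ) (hc : closedBall c ρ ⊆ W) (hx : x ∈ closedBall c ρ) :
    c = x - ρ • ν := by
  have h := hν.inner_center_le hρ hc
  have hd : ‖c - x‖ ≤ ρ := by rwa [mem_closedBall, dist_comm, dist_eq_norm] at hx
  have hsq : ‖(c - x) + ρ • ν‖ ^ 2 ≤ 0 := by
    rw [norm_add_sq_real, inner_smul_right, norm_smul, h1, real_inner_comm, Real.norm_eq_abs,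
      abs_of_nonneg hρ]
    rw [h1] at h
    nlinarith [norm_nonneg (c - x)]
  have : (c - x) + ρ • ν = 0 := by
    rw [← norm_eq_zero]; nlinarith [norm_nonneg ((c - x) + ρ • ν)]
  rw [sub_add_eq_add_sub, sub_eq_zero] at this
  rw [← this]; abel

/-- Interior balls of radius at least `r` make the Gauss map `1/r`-Lipschitz. -/
theorem norm_normal_sub_le {W : Set E} {x y ν ν' : E} {r ρ ρ' : ℝ} (hr : 0 < r)
    (hν : IsNormalAt W x ν) (hν' : IsNormalAt W y ν') (h1 : ‖ν‖ = 1) (h1' : ‖ν'‖ = 1)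
    (hρ : r ≤ ρ) (hρ' : r ≤ ρ') (hx : TouchedByBall W ρ x) (hy : TouchedByBall W ρ' y) :
    r * ‖ν - ν'‖ ≤ ‖x - y‖ := by
  obtain ⟨c, hc, hxc⟩ := hx
  obtain ⟨c', hc', hyc'⟩ := hy
  have e1 := hν.center_eq h1 (hr.le.trans hρ) hc hxc
  have e2 := hν'.center_eq h1' (hr.le.trans hρ') hc' hyc'
  have a1 := hν.inner_center_le (hr.le.trans hρ') hc'
  have a2 := hν'.inner_center_le (hr.le.trans hρ) hc
  have s1 : y - ρ' • ν' - x = (y - x) - ρ' • ν' := by abel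
  have s2 : x - ρ • ν - y = -(y - x) - ρ • ν := by abel
  rw [e2, h1, s1, inner_sub_right, inner_smul_right] at a1
  rw [e1, h1', s2, inner_sub_right, inner_neg_right, inner_smul_right, real_inner_comm ν ν'] at a2
  have hsq : ‖ν - ν'‖ ^ 2 = 2 * (1 - ⟪ν, ν'⟫_ℝ) := by
    rw [norm_sub_sq_real, h1, h1']; ring
  have hi : ⟪ν, ν'⟫_ℝ ≤ 1 := by
    have := real_inner_le_norm ν ν'
    rwa [h1, h1', one_mul] at this
  have hcs : ⟪ν - ν', x - y⟫_ℝ ≤ ‖ν - ν'‖ * ‖x - y‖ := real_inner_le_norm _ _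
  have hexp : ⟪ν - ν', x - y⟫_ℝ = -⟪ν, y - x⟫_ℝ + ⟪ν', y - x⟫_ℝ := by
    rw [inner_sub_left, ← neg_sub y x, inner_neg_right, inner_neg_right]; ring
  -- Adding `a1` and `a2`, each normal tested against the other ball, gives `(ρ + ρ')(1 - ⟪ν, ν'⟫) ≤
  -- ⟪ν - ν', x - y⟫`.
  have key : r * ‖ν - ν'‖ ^ 2 ≤ ‖ν - ν'‖ * ‖x - y‖ := by
    nlinarith [mul_le_mul_of_nonneg_right hρ (sub_nonneg.2 hi),
      mul_le_mul_of_nonneg_right hρ' (sub_nonneg.2 hi)]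
  rcases (norm_nonneg (ν - ν')).eq_or_lt with h | h
  · rw [← h]; simp
  · exact le_of_mul_le_mul_left (by nlinarith) h

theorem exists_isNormalAt [FiniteDimensional ℝ E] {W : Set E} (hconv : Convex ℝ W) (hint : (interior W).Nonempty) {x : E}
    (hx : x ∈ frontier W) : ∃ ν, ‖ν‖ = 1 ∧ IsNormalAt W x ν := by
  obtain ⟨f, hf⟩ := geometric_hahn_banach_open_point hconv.interior isOpen_interior hx.2
  have hle : ∀ q ∈ W, f q ≤ f x := by
    intro q hq
    have hcl : q ∈ closure (interior W) := by
      rw [hconv.closure_interior_eq_closure_of_nonempty_interior hint]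
      exact subset_closure hq
    exact closure_minimal (s := interior W) (t := {q | f q ≤ f x}) (fun a ha => (hf a ha).le)
      (isClosed_le f.continuous continuous_const) hcl
  set w := (InnerProductSpace.toDual ℝ E).symm f with hw
  have hwf : ∀ y, ⟪w, y⟫_ℝ = f y := fun y => InnerProductSpace.toDual_symm_apply
  have hw0 : w ≠ 0 := by
    intro h0
    obtain ⟨a, ha⟩ := hint
    have := hf a ha
    rw [← hwf, ← hwf, h0, inner_zero_left, inner_zero_left] at this
    exact lt_irrefl _ this
  have hn : 0 < ‖w‖ := norm_pos_iff.2 hw0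
  refine ⟨‖w‖⁻¹ • w, ?_, fun q hq => ?_⟩
  · rw [norm_smul, norm_inv, norm_norm, inv_mul_cancel₀ hn.ne']
  · rw [real_inner_smul_left, inner_sub_right, hwf, hwf]
    exact mul_nonpos_of_nonneg_of_nonpos (inv_nonneg.2 hn.le) (sub_nonpos.2 (hle q hq))

/-- The hyperplane orthogonal to `e`. -/
noncomputable abbrev orthHyperplane (e : E) : Submodule ℝ E := (Submodule.span ℝ {e})ᗮ

/-- The orthogonal projection to the hyperplane `e^⊥`. -/
noncomputable abbrev hypProj (e : E) : E →L[ℝ] orthHyperplane e :=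
  (orthHyperplane e).orthogonalProjectionOnto

theorem coe_hypProj {e : E} (he : ‖e‖ = 1) (x : E) :
    (hypProj e x : E) = x - ⟪e, x⟫_ℝ • e := by
  rw [← Submodule.starProjection_apply, Submodule.starProjection_orthogonal_val,
    Submodule.starProjection_unit_singleton ℝ he]

theorem hypProj_add_smul {e : E} (he : ‖e‖ = 1) (x : E) :
    (hypProj e x : E) + ⟪e, x⟫_ℝ • e = x := by
  rw [coe_hypProj he, sub_add_cancel]

theorem inner_coe_orthHyperplane {e : E} (h : orthHyperplane e) : ⟪e, (h : E)⟫_ℝ = 0 :=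
  Submodule.mem_orthogonal_singleton_iff_inner_right.1 h.2

theorem hypProj_graph {e : E} (he : ‖e‖ = 1) (h : orthHyperplane e) (t : ℝ) :
    hypProj e ((h : E) + t • e) = h := by
  apply Subtype.ext
  rw [coe_hypProj he, inner_add_right, inner_coe_orthHyperplane, inner_smul_right,
    real_inner_self_eq_norm_sq, he]
  simp

theorem inner_graph {e : E} (he : ‖e‖ = 1) (h : orthHyperplane e) (t : ℝ) :
    ⟪e, (h : E) + t • e⟫_ℝ = t := by
  rw [inner_add_right, inner_coe_orthHyperplane, inner_smul_right, real_inner_self_eq_norm_sq, he]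
  simp

theorem norm_hypProj_le {e : E} (x : E) : ‖hypProj e x‖ ≤ ‖x‖ :=
  Submodule.norm_orthogonalProjectionOnto_apply_le _ x

theorem inner_coe_eq_inner_hypProj {e : E} (ν : E) (h : orthHyperplane e) :
    ⟪ν, (h : E)⟫_ℝ = ⟪hypProj e ν, h⟫_ℝ :=
  (Submodule.inner_orthogonalProjectionOnto_eq_of_mem_right h ν).symm

end ConvexGeometry

/-! ### The frontier as a graph near each of its points. -/

section GraphChart

variable {E : Type*} [NormedAddCommGroup E] [InnerProductSpace ℝ E]

/-- A local description of the frontier of the convex set `W` as the graph, in the direction of the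
unit vector `e`, of a function on a ball of `e^⊥`, with `W` on the upper side of the graph. -/
structure GraphChart (W : Set E) where
  e : E
  norm_e : ‖e‖ = 1
  center : orthHyperplane e
  radius : ℝ
  f : orthHyperplane e → ℝ
  U : Set E
  κ : ℝ
  κ_pos : 0 < κ
  isOpen_U : IsOpen U
  hypProj_mem : ∀ q ∈ U, hypProj e q ∈ ball center radius
  frontier_inter : frontier W ∩ U = (fun h : orthHyperplane e => (h : E) + f h • e) '' ball center radius
  mem_of_le : ∀ q ∈ U, f (hypProj e q) ≤ ⟪e, q⟫_ℝ → q ∈ W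
  normal_le : ∀ h : orthHyperplane e, h ∈ ball center radius → ∀ ν, IsNormalAt W ((h : E) + f h • e) ν →
    κ * ‖ν‖ ≤ -⟪ν, e⟫_ℝ

/-- The axis `e` points from `x₀` to the centre of an interior ball. Over a small disc in `e^⊥`, the
ball bounds the lower sheet of the frontier from above and the supporting hyperplane at `x₀` bounds
it from below. -/
theorem exists_graphChart [FiniteDimensional ℝ E] {W : Set E} (hcl : IsClosed W)
    (hconv : Convex ℝ W) (hint : (interior W).Nonempty) {x₀ : E} (hx₀ : x₀ ∈ frontier W) :
    ∃ G : GraphChart W, x₀ ∈ G.U := by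
  obtain ⟨c, hc⟩ := hint
  obtain ⟨δ, hδ, hball⟩ := nhds_basis_closedBall.mem_iff.1 (mem_interior_iff_mem_nhds.1 hc)
  obtain ⟨ν₀, hν₀, hN₀⟩ := exists_isNormalAt hconv ⟨c, hc⟩ hx₀
  have hne : c ≠ x₀ := fun h => hx₀.2 (h ▸ hc)
  set a := ‖c - x₀‖ with ha_def
  have ha : 0 < a := norm_pos_iff.2 (sub_ne_zero.2 hne)
  obtain ⟨e, he_def⟩ : ∃ e, e = a⁻¹ • (c - x₀) := ⟨_, rfl⟩
  have he : ‖e‖ = 1 := by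
    rw [he_def, norm_smul, norm_inv, Real.norm_eq_abs, abs_of_pos ha, ← ha_def,
      inv_mul_cancel₀ ha.ne']
  have hce : c = x₀ + a • e := by
    rw [he_def, smul_smul, mul_inv_cancel₀ ha.ne', one_smul]; abel
  set h₀ := hypProj e x₀ with hh₀
  set t₀ := ⟪e, x₀⟫_ℝ with ht₀
  set tc := t₀ + a with htc
  have hx₀e : x₀ = (h₀ : E) + t₀ • e := (hypProj_add_smul he x₀).symm
  have hcc : c = (h₀ : E) + tc • e := by
    rw [hce, htc, add_smul, ← add_assoc, ← hx₀e]
  have hκ₀ : δ ≤ -⟪ν₀, e⟫_ℝ * a := by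
    have := hN₀.inner_center_le hδ.le hball
    rw [hce, add_sub_cancel_left, inner_smul_right, hν₀] at this
    linarith
  have hD : ∀ h : orthHyperplane e, h ∈ ball h₀ (δ / 2) → closedBall ((h : E) + tc • e) (δ / 2) ⊆ W := by
    intro h hh
    refine (closedBall_subset_closedBall' ?_).trans hball
    rw [hcc, dist_add_right]
    have : dist (h : E) h₀ < δ / 2 := hh
    linarith
  have hlow : ∀ h : orthHyperplane e, h ∈ ball h₀ (δ / 2) → ∀ t : ℝ, (h : E) + t • e ∈ W → t₀ - a / 2 ≤ t := by
    intro h hh t ht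
    have h1 := hN₀ _ ht
    have h2 : (h : E) + t • e - x₀ = ((h : E) - h₀) + (t - t₀) • e := by
      conv_lhs => rw [hx₀e]
      rw [sub_smul]; abel
    rw [h2, inner_add_right, inner_smul_right] at h1
    have h3 : ‖(h : E) - h₀‖ < δ / 2 := by
      rw [← dist_eq_norm]; exact hh
    have h4 := abs_real_inner_le_norm ν₀ ((h : E) - h₀)
    rw [hν₀, one_mul] at h4
    have h5 := (abs_le.1 h4).1
    by_contra! hlt
    have h6 : a / 2 * (-⟪ν₀, e⟫_ℝ) < (t₀ - t) * (-⟪ν₀, e⟫_ℝ) := by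
      apply mul_lt_mul_of_pos_right (by linarith)
      by_contra! hneg
      nlinarith
    nlinarith
  set T : orthHyperplane e → Set ℝ := fun h => {t | (h : E) + t • e ∈ W} with hT
  set f : orthHyperplane e → ℝ := fun h => sInf (T h) with hf
  have hTcl : ∀ h, IsClosed (T h) := fun h =>
    hcl.preimage (by fun_prop : Continuous fun t : ℝ => (h : E) + t • e)
  have hmemT : ∀ h : orthHyperplane e, h ∈ ball h₀ (δ / 2) → tc - δ / 2 ∈ T h := by
    intro h hh
    apply hD h hh
    rw [mem_closedBall, dist_add_left, dist_eq_norm, ← sub_smul, norm_smul, he, mul_one,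
      Real.norm_eq_abs, sub_sub_cancel_left, abs_neg, abs_of_pos (by linarith)]
  have hbdd : ∀ h : orthHyperplane e, h ∈ ball h₀ (δ / 2) → BddBelow (T h) := fun h hh =>
    ⟨t₀ - a / 2, fun t ht => hlow h hh t ht⟩
  have hfmem : ∀ h : orthHyperplane e, h ∈ ball h₀ (δ / 2) → (h : E) + f h • e ∈ W := fun h hh =>
    (hTcl h).csInf_mem ⟨_, hmemT h hh⟩ (hbdd h hh)
  have hflt : ∀ h : orthHyperplane e, h ∈ ball h₀ (δ / 2) → f h ≤ tc - δ / 2 := fun h hh =>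
    csInf_le (hbdd h hh) (hmemT h hh)
  have hfge : ∀ h : orthHyperplane e, h ∈ ball h₀ (δ / 2) → t₀ - a / 2 ≤ f h := fun h hh => hlow h hh _ (hfmem h hh)
  have hinside : ∀ h : orthHyperplane e, h ∈ ball h₀ (δ / 2) → ∀ t, f h < t → t < tc → (h : E) + t • e ∈ interior W := by
    intro h hh t h1 h2
    have hci : (h : E) + tc • e ∈ interior W := by
      rw [mem_interior_iff_mem_nhds]
      exact mem_of_superset (closedBall_mem_nhds _ (by linarith)) (hD h hh)
    apply hconv.openSegment_interior_self_subset_interior hci (hfmem h hh)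
    have hpos : 0 < tc - f h := by linarith
    refine ⟨(t - f h) / (tc - f h), (tc - t) / (tc - f h), div_pos (by linarith) hpos,
      div_pos (by linarith) hpos, by field_simp; ring, ?_⟩
    rw [smul_add, smul_add, smul_smul, smul_smul, add_add_add_comm, ← add_smul, ← add_smul]
    have e1 : (t - f h) / (tc - f h) + (tc - t) / (tc - f h) = 1 := by field_simp; ring
    have e2 : (t - f h) / (tc - f h) * tc + (tc - t) / (tc - f h) * f h = t := by
      field_simp; ring
    rw [e1, e2, one_smul]
  -- Cutting the cylinder at the height of the centre removes any upper sheet.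
  set U : Set E := {q | hypProj e q ∈ ball h₀ (δ / 2) ∧ ⟪e, q⟫_ℝ < tc} with hU
  -- The slope bound `δ / (3a)`: a ball of radius `δ / 2` sits at height at most `3a / 2` above each
  -- graph point.
  refine ⟨⟨e, he, h₀, δ / 2, f, U, δ / (3 * a), by positivity, ?_, fun q hq => hq.1, ?_, ?_, ?_⟩,
    ?_⟩
  · have h1 : IsOpen {q : E | ⟪e, q⟫_ℝ < tc} := isOpen_lt (by fun_prop) continuous_const
    exact (isOpen_ball.preimage (hypProj e).continuous).inter h1
  · ext x
    constructor
    · rintro ⟨hxf, hxU⟩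
      refine ⟨hypProj e x, hxU.1, ?_⟩
      have hxe := hypProj_add_smul he x
      have hxW : x ∈ W := hcl.frontier_subset hxf
      have hle : f (hypProj e x) ≤ ⟪e, x⟫_ℝ := by
        refine csInf_le (hbdd _ hxU.1) ?_
        change (hypProj e x : E) + ⟪e, x⟫_ℝ • e ∈ W
        rwa [hxe]
      rcases hle.eq_or_lt with h | h
      · change (hypProj e x : E) + f (hypProj e x) • e = x
        rw [h, hxe]
      · have := hinside _ hxU.1 _ h hxU.2
        rw [hxe] at this
        exact absurd this hxf.2
    · rintro ⟨h, hh, rfl⟩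
      refine ⟨?_, ?_⟩
      · refine ⟨subset_closure (hfmem h hh), fun hi => ?_⟩
        obtain ⟨r, hr, hrW⟩ := nhds_basis_closedBall.mem_iff.1 (mem_interior_iff_mem_nhds.1 hi)
        have : f h - r ∈ T h := by
          apply hrW
          change (h : E) + (f h - r) • e ∈ closedBall ((h : E) + f h • e) r
          rw [mem_closedBall, dist_add_left, dist_eq_norm, ← sub_smul, norm_smul, he, mul_one,
            Real.norm_eq_abs, sub_sub_cancel_left, abs_neg, abs_of_pos hr]
        have := csInf_le (hbdd h hh) this
        change f h ≤ _ at this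
        linarith
      · refine ⟨?_, ?_⟩
        · change hypProj e ((h : E) + f h • e) ∈ _
          rwa [hypProj_graph he]
        · change ⟪e, (h : E) + f h • e⟫_ℝ < tc
          rw [inner_graph he]
          linarith [hflt h hh]
  · intro q hq hle
    have hqe := hypProj_add_smul he q
    rcases hle.eq_or_lt with h | h
    · rw [← hqe, ← h]; exact hfmem _ hq.1
    · rw [← hqe]; exact interior_subset (hinside _ hq.1 _ h hq.2)
  · intro h hh ν hν
    have h1 := hν.inner_center_le (by linarith : 0 ≤ δ / 2) (hD h hh)
    rw [add_sub_add_left_eq_sub, ← sub_smul, inner_smul_right] at h1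
    have h2 := hflt h hh
    have h3 := hfge h hh
    have hs : 0 ≤ -⟪ν, e⟫_ℝ := by
      by_contra! hneg
      have : 0 < (tc - f h) * ⟪ν, e⟫_ℝ := mul_pos (by linarith) (by linarith)
      nlinarith [norm_nonneg ν]
    rw [div_mul_eq_mul_div, div_le_iff₀ (by positivity)]
    have h4 : (tc - f h) * (-⟪ν, e⟫_ℝ) ≤ (3 * a / 2) * (-⟪ν, e⟫_ℝ) :=
      mul_le_mul_of_nonneg_right (by linarith) hs
    nlinarith
  · exact ⟨mem_ball_self (by linarith), by change t₀ < tc; linarith⟩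

end GraphChart

/-! ### Interior balls imply `C^{1,1}` regularity. -/

section GraphChartLemmas

variable {E : Type*} [NormedAddCommGroup E] [InnerProductSpace ℝ E]

namespace GraphChart

variable {W : Set E} (G : GraphChart W)

/-- The graph parametrization of the chart. -/
noncomputable def graph (h : orthHyperplane G.e) : E := (h : E) + G.f h • G.e

theorem graph_mem {h : orthHyperplane G.e} (hh : h ∈ ball G.center G.radius) :
    G.graph h ∈ frontier W ∩ G.U := by
  rw [G.frontier_inter]; exact ⟨h, hh, rfl⟩

theorem graph_hypProj {x : E} (hx : x ∈ frontier W ∩ G.U) : G.graph (hypProj G.e x) = x := by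
  rw [G.frontier_inter] at hx
  obtain ⟨h, hh, rfl⟩ := hx
  change G.graph (hypProj G.e ((h : E) + G.f h • G.e)) = _
  rw [hypProj_graph G.norm_e]; rfl

/-- The slope of the supporting hyperplane with normal `ν`. -/
noncomputable def slope (ν : E) : orthHyperplane G.e := (-⟪ν, G.e⟫_ℝ)⁻¹ • hypProj G.e ν

theorem le_neg_inner {h : orthHyperplane G.e} (hh : h ∈ ball G.center G.radius) {ν : E}
    (hν : IsNormalAt W (G.graph h) ν) (h1 : ‖ν‖ = 1) : G.κ ≤ -⟪ν, G.e⟫_ℝ := by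
  have := G.normal_le h hh ν hν
  rwa [h1, mul_one] at this

theorem neg_inner_le {ν : E} (h1 : ‖ν‖ = 1) : -⟪ν, G.e⟫_ℝ ≤ 1 := by
  have := (abs_le.1 (abs_real_inner_le_norm ν G.e)).1
  rw [h1, G.norm_e] at this
  linarith

theorem norm_slope_le {h : orthHyperplane G.e} (hh : h ∈ ball G.center G.radius) {ν : E}
    (hν : IsNormalAt W (G.graph h) ν) (h1 : ‖ν‖ = 1) : ‖G.slope ν‖ ≤ G.κ⁻¹ := by
  have h2 := G.le_neg_inner hh hν h1
  have hκ := G.κ_pos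
  rw [slope, norm_smul, norm_inv, Real.norm_eq_abs, abs_of_pos (hκ.trans_le h2)]
  calc _ ≤ G.κ⁻¹ * 1 := by
        gcongr
        rw [← h1]; exact norm_hypProj_le ν
    _ = _ := mul_one _

/-- The supporting hyperplane read in the chart: slopes of normals are subgradients of `G.f`. -/
theorem add_inner_slope_le (hcl : IsClosed W) {h h' : orthHyperplane G.e}
    (hh : h ∈ ball G.center G.radius) (hh' : h' ∈ ball G.center G.radius) {ν : E}
    (hν : IsNormalAt W (G.graph h) ν) (h1 : ‖ν‖ = 1) :
    G.f h + ⟪G.slope ν, h' - h⟫_ℝ ≤ G.f h' := by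
  have h2 := G.le_neg_inner hh hν h1
  have hs : 0 < -⟪ν, G.e⟫_ℝ := G.κ_pos.trans_le h2
  have h3 := hν _ (hcl.frontier_subset (G.graph_mem hh').1)
  have h4 : G.graph h' - G.graph h
      = ((h' - h : orthHyperplane G.e) : E) + (G.f h' - G.f h) • G.e := by
    rw [graph, graph, sub_smul, Submodule.coe_sub]; abel
  rw [h4, inner_add_right, inner_smul_right, inner_coe_eq_inner_hypProj] at h3
  rw [slope, real_inner_smul_left, inv_mul_eq_div, ← le_sub_iff_add_le', div_le_iff₀ hs]
  linarith

theorem abs_f_sub_le [FiniteDimensional ℝ E] (hcl : IsClosed W) (hconv : Convex ℝ W)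
    (hint : (interior W).Nonempty) {h h' : orthHyperplane G.e}
    (hh : h ∈ ball G.center G.radius) (hh' : h' ∈ ball G.center G.radius) :
    |G.f h - G.f h'| ≤ G.κ⁻¹ * ‖h - h'‖ := by
  have key : ∀ {h h' : orthHyperplane G.e}, h ∈ ball G.center G.radius →
      h' ∈ ball G.center G.radius → G.f h - G.f h' ≤ G.κ⁻¹ * ‖h - h'‖ := by
    intro h h' hh hh'
    obtain ⟨ν, h1, hν⟩ := exists_isNormalAt hconv hint (G.graph_mem hh).1
    have h2 := G.add_inner_slope_le hcl hh hh' hν h1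
    have h3 := (abs_le.1 (abs_real_inner_le_norm (G.slope ν) (h' - h))).1
    have h4 := mul_le_mul_of_nonneg_right (G.norm_slope_le hh hν h1) (norm_nonneg (h' - h))
    rw [norm_sub_rev h' h] at *
    linarith
  rw [abs_sub_le_iff]
  refine ⟨key hh hh', ?_⟩
  rw [norm_sub_rev]; exact key hh' hh

theorem lipschitzOnWith_graph [FiniteDimensional ℝ E] (hcl : IsClosed W) (hconv : Convex ℝ W)
    (hint : (interior W).Nonempty) :
    LipschitzOnWith (1 + G.κ⁻¹).toNNReal G.graph (ball G.center G.radius) := by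
  have hκ := G.κ_pos
  refine LipschitzOnWith.of_dist_le_mul fun h hh h' hh' => ?_
  rw [Real.coe_toNNReal _ (by positivity), dist_eq_norm, dist_eq_norm]
  have h4 : G.graph h - G.graph h'
      = ((h - h' : orthHyperplane G.e) : E) + (G.f h - G.f h') • G.e := by
    rw [graph, graph, sub_smul, Submodule.coe_sub]; abel
  rw [h4]
  refine (norm_add_le _ _).trans ?_
  rw [norm_smul, G.norm_e, mul_one, Real.norm_eq_abs, add_mul, one_mul]
  exact add_le_add le_rfl (G.abs_f_sub_le hcl hconv hint hh hh')

theorem norm_slope_sub_le {h h' : orthHyperplane G.e}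
    (hh : h ∈ ball G.center G.radius) (hh' : h' ∈ ball G.center G.radius) {ν ν' : E}
    (hν : IsNormalAt W (G.graph h) ν) (h1 : ‖ν‖ = 1) (hν' : IsNormalAt W (G.graph h') ν')
    (h1' : ‖ν'‖ = 1) :
    ‖G.slope ν - G.slope ν'‖ ≤ (G.κ⁻¹ + G.κ⁻¹ ^ 2) * ‖ν - ν'‖ := by
  have hκ := G.κ_pos
  have h2 := G.le_neg_inner hh hν h1
  have h2' := G.le_neg_inner hh' hν' h1'
  have hb' := G.norm_slope_le hh' hν' h1'
  set s := -⟪ν, G.e⟫_ℝ with hs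
  set s' := -⟪ν', G.e⟫_ℝ with hs'
  have hspos : 0 < s := hκ.trans_le h2
  have hspos' : 0 < s' := hκ.trans_le h2'
  have hss : |s' - s| ≤ ‖ν - ν'‖ := by
    have e : s' - s = ⟪ν - ν', G.e⟫_ℝ := by rw [inner_sub_left, hs, hs']; ring
    rw [e]
    have := abs_real_inner_le_norm (ν - ν') G.e
    rwa [G.norm_e, mul_one] at this
  have hd : G.slope ν - G.slope ν'
      = s⁻¹ • (hypProj G.e (ν - ν')) + (s⁻¹ * (s' - s)) • G.slope ν' := by
    rw [slope, slope, ← hs, ← hs', map_sub, smul_sub, smul_smul]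
    have : s⁻¹ * (s' - s) * s'⁻¹ = s⁻¹ - s'⁻¹ := by field_simp
    rw [this, sub_smul]; abel
  have hsinv : s⁻¹ ≤ G.κ⁻¹ := inv_anti₀ hκ h2
  rw [hd]
  refine (norm_add_le _ _).trans ?_
  rw [norm_smul, norm_smul, norm_mul, norm_inv, Real.norm_eq_abs, abs_of_pos hspos,
    Real.norm_eq_abs]
  calc _ ≤ G.κ⁻¹ * ‖ν - ν'‖ + G.κ⁻¹ * ‖ν - ν'‖ * G.κ⁻¹ := by
        gcongr
        exact norm_hypProj_le _
    _ = _ := by ring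

end GraphChart

/-- A function with a Lipschitz field of subgradients on an open set is of class `C^{1,1}`. -/
theorem isC11On_of_lipschitz_subgradient {H : Type*} [NormedAddCommGroup H] [InnerProductSpace ℝ H]
    {f : H → ℝ} {D : Set H} {p : H → H} {L : NNReal} (hD : IsOpen D)
    (hsub : ∀ x ∈ D, ∀ y ∈ D, f x + ⟪p x, y - x⟫_ℝ ≤ f y) (hp : LipschitzOnWith L p D) :
    IsC11On f D := by
  have hder : ∀ x ∈ D, HasFDerivAt f (innerSL ℝ (p x)) x := by
    intro x hx
    rw [hasFDerivAt_iff_isLittleO]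
    -- The subgradient inequalities at `x` and at `y` trap the remainder between `0` and `⟪p y - p
    -- x, y - x⟫`.
    have hbig : (fun y => f y - f x - innerSL ℝ (p x) (y - x))
        =O[𝓝 x] fun y => ‖y - x‖ ^ 2 := by
      refine Asymptotics.IsBigO.of_bound L ?_
      filter_upwards [hD.mem_nhds hx] with y hy
      rw [innerSL_apply_apply, Real.norm_eq_abs, norm_pow, norm_norm]
      have h1 := hsub x hx y hy
      have h2 := hsub y hy x hx
      have h3 : ⟪p y, x - y⟫_ℝ = -⟪p y - p x, y - x⟫_ℝ - ⟪p x, y - x⟫_ℝ := by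
        rw [← neg_sub y x, inner_neg_right, inner_sub_left]; ring
      have h4 := real_inner_le_norm (p y - p x) (y - x)
      have h5 : ‖p y - p x‖ ≤ L * ‖y - x‖ := by
        rw [← dist_eq_norm, ← dist_eq_norm]; exact hp.dist_le_mul y hy x hx
      have h6 := mul_le_mul_of_nonneg_right h5 (norm_nonneg (y - x))
      rw [abs_of_nonneg (by linarith)]
      nlinarith
    refine hbig.trans_isLittleO ?_
    have h0 : Tendsto (fun y : H => y - x) (𝓝 x) (𝓝 0) := by
      have : Continuous fun y : H => y - x := by fun_prop
      simpa using this.tendsto x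
    exact (Asymptotics.isLittleO_norm_pow_id one_lt_two).comp_tendsto h0
  have hlip : LipschitzOnWith L (fderiv ℝ f) D := by
    refine LipschitzOnWith.of_dist_le_mul fun x hx y hy => ?_
    rw [(hder x hx).fderiv, (hder y hy).fderiv, dist_eq_norm, ← map_sub, innerSL_apply_norm,
      ← dist_eq_norm]
    exact hp.dist_le_mul x hx y hy
  refine ⟨hD, ?_, L, hlip⟩
  rw [show (1 : WithTop ℕ∞) = 0 + 1 from (zero_add 1).symm, contDiffOn_succ_iff_fderiv_of_isOpen hD]
  exact ⟨fun x hx => (hder x hx).differentiableAt.differentiableWithinAt, by simp,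
    contDiffOn_zero.2 hlip.continuousOn⟩

/-- A convex body whose frontier points are touched by interior balls of locally uniform radii
has a `C^{1,1}_loc` frontier. -/
theorem isC11LocHypersurface_frontier {n : ℕ} {W : Set (EuclideanSpace ℝ (Fin n))}
    (hW : IsConvexBodyUnbdd W)
    (hball : ∀ x₀ ∈ frontier W, ∃ r > 0, ∀ᶠ x in 𝓝 x₀, x ∈ frontier W →
      ∃ ρ, r ≤ ρ ∧ TouchedByBall W ρ x) :
    IsC11LocHypersurface (frontier W) := by
  intro x₀ hx₀
  obtain ⟨G, hxG⟩ := exists_graphChart hW.isClosed hW.convex hW.interior_nonempty hx₀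
  obtain ⟨r, hr, hev⟩ := hball x₀ hx₀
  obtain ⟨V, hV, hVo, hxV⟩ := _root_.eventually_nhds_iff.1 hev
  have hLip := G.lipschitzOnWith_graph hW.isClosed hW.convex hW.interior_nonempty
  set D := ball G.center G.radius ∩ G.graph ⁻¹' V with hD
  have hDo : IsOpen D := hLip.continuousOn.isOpen_inter_preimage isOpen_ball hVo
  refine ⟨G.U ∩ V, G.isOpen_U.inter hVo, ⟨hxG, hxV⟩, G.e, G.norm_e, D, G.f, ?_, ?_⟩
  · have hex : ∀ h : orthHyperplane G.e, ∃ ν, h ∈ D → ‖ν‖ = 1 ∧ IsNormalAt W (G.graph h) ν := by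
      intro h
      by_cases hh : h ∈ D
      · obtain ⟨ν, h1, h2⟩ := exists_isNormalAt hW.convex hW.interior_nonempty
          (G.graph_mem hh.1).1
        exact ⟨ν, fun _ => ⟨h1, h2⟩⟩
      · exact ⟨0, fun h' => absurd h' hh⟩
    choose ν hν using hex
    have hκ := G.κ_pos
    -- The constant multiplies three Lipschitz bounds: slope in the normal, normal in the frontier
    -- point (`r⁻¹`), frontier point in the chart parameter.
    refine isC11On_of_lipschitz_subgradient (p := fun h => G.slope (ν h))
      (L := ((G.κ⁻¹ + G.κ⁻¹ ^ 2) * (r⁻¹ * (1 + G.κ⁻¹))).toNNReal) hDo ?_ ?_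
    · intro x hx y hy
      exact G.add_inner_slope_le hW.isClosed hx.1 hy.1 (hν x hx).2 (hν x hx).1
    · refine LipschitzOnWith.of_dist_le_mul fun x hx y hy => ?_
      rw [Real.coe_toNNReal _ (by positivity), dist_eq_norm]
      refine (G.norm_slope_sub_le hx.1 hy.1 (hν x hx).2 (hν x hx).1 (hν y hy).2
        (hν y hy).1).trans ?_
      rw [mul_assoc]
      gcongr
      obtain ⟨ρ, hρ, hb⟩ := hV _ hx.2 (G.graph_mem hx.1).1
      obtain ⟨ρ', hρ', hb'⟩ := hV _ hy.2 (G.graph_mem hy.1).1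
      have h1 := norm_normal_sub_le hr (hν x hx).2 (hν y hy).2 (hν x hx).1 (hν y hy).1 hρ hρ' hb hb'
      have h2 := hLip.dist_le_mul x hx.1 y hy.1
      rw [Real.coe_toNNReal _ (by positivity), dist_eq_norm] at h2
      rw [mul_assoc, ← div_eq_inv_mul, le_div_iff₀' hr]
      exact h1.trans h2
  · rw [← inter_assoc, G.frontier_inter]
    ext x
    constructor
    · rintro ⟨⟨h, hh, rfl⟩, hxV⟩
      exact ⟨h, ⟨hh, hxV⟩, rfl⟩
    · rintro ⟨h, hh, rfl⟩
      exact ⟨⟨h, hh.1, rfl⟩, hh.2⟩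

end GraphChartLemmas

/-! ### Hausdorff measure under Lipschitz and distance-nondecreasing maps. -/

section HausdorffMeasure

variable {X Y : Type*} [EMetricSpace X] [MeasurableSpace X] [BorelSpace X]
  [EMetricSpace Y] [MeasurableSpace Y] [BorelSpace Y]

theorem LipschitzOnWith.euclideanHausdorffMeasure_image_le {K : NNReal} {f : X → Y} {s : Set X}
    (hf : LipschitzOnWith K f s) (d : ℕ) : μHE[d] (f '' s) ≤ (K : ENNReal) ^ d * μHE[d] s := by
  simp only [Measure.euclideanHausdorffMeasure_def, Measure.smul_apply, ENNReal.smul_def, smul_eq_mul]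
  have := hf.hausdorffMeasure_image_le (d := d) (Nat.cast_nonneg d)
  rw [ENNReal.rpow_natCast] at this
  calc _ ≤ _ := mul_le_mul_right this _
    _ = _ := by ring

/-- A set that is mapped in a distance nondecreasing way has at most the measure of its image. -/
theorem euclideanHausdorffMeasure_le_image {f : X → Y} {s : Set X} (d : ℕ)
    (hf : ∀ x ∈ s, ∀ y ∈ s, edist x y ≤ edist (f x) (f y)) : μHE[d] s ≤ μHE[d] (f '' s) := by
  rcases s.eq_empty_or_nonempty with rfl | ⟨x₀, -⟩
  · simp
  have : Nonempty X := ⟨x₀⟩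
  have hinj : InjOn f s := fun x hx y hy hxy => by
    have := hf x hx y hy
    rw [hxy, edist_self] at this
    exact edist_le_zero.1 this
  have hinv := hinj.leftInvOn_invFunOn
  have hL : LipschitzOnWith 1 (Function.invFunOn f s) (f '' s) := by
    rintro _ ⟨x, hx, rfl⟩ _ ⟨y, hy, rfl⟩
    rw [hinv hx, hinv hy, ENNReal.coe_one, one_mul]
    exact hf x hx y hy
  have := hL.euclideanHausdorffMeasure_image_le d
  rwa [hinv.image_image, ENNReal.coe_one, one_pow, one_mul] at this

end HausdorffMeasure

/-! ### Quadratic upper bounds for convex functions almost everywhere. -/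

section SecondOrder

variable {H : Type*} [NormedAddCommGroup H] [InnerProductSpace ℝ H]

/-- `f` lies below a paraboloid touching its graph at `x` with slope `p x`. -/
def HasQuadraticUpperBound (f : H → ℝ) (p : H → H) (D : Set H) (x : H) : Prop :=
  ∃ C r : ℝ, 0 < r ∧ 0 ≤ C ∧
    ∀ y ∈ D, ‖y - x‖ < r → f y ≤ f x + ⟪p x, y - x⟫_ℝ + C * ‖y - x‖ ^ 2

/-- Subgradients are continuous at points of differentiability. -/
theorem continuousWithinAt_subgradient {f : H → ℝ} {p : H → H} {D : Set H} (hD : IsOpen D)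
    (hsub : ∀ x ∈ D, ∀ y ∈ D, f x + ⟪p x, y - x⟫_ℝ ≤ f y) {x : H} (hx : x ∈ D)
    {f' : H →L[ℝ] ℝ} (hf : HasFDerivAt f f' x) : ContinuousWithinAt p D x := by
  have hp : ∀ w, f' w = ⟪p x, w⟫_ℝ := by
    have hle : ∀ w, ⟪p x, w⟫_ℝ ≤ f' w := by
      intro w
      have h1 : Tendsto (fun t : ℝ => t⁻¹ • (f (x + t • w) - f x)) (𝓝[>] 0) (𝓝 (f' w)) :=
        hf.hasLineDerivAt w |>.tendsto_slope_zero_right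
      refine ge_of_tendsto h1 ?_
      have h2 : ∀ᶠ t : ℝ in 𝓝[>] 0, x + t • w ∈ D := by
        have hc : Continuous fun t : ℝ => x + t • w := by fun_prop
        have : Tendsto (fun t : ℝ => x + t • w) (𝓝 0) (𝓝 x) := by simpa using hc.tendsto 0
        exact (this.mono_left nhdsWithin_le_nhds) (hD.mem_nhds hx)
      filter_upwards [h2, self_mem_nhdsWithin] with t ht htpos
      have htpos : 0 < t := htpos
      have h3 := hsub x hx _ ht
      rw [add_sub_cancel_left, inner_smul_right] at h3
      rw [smul_eq_mul, ← div_eq_inv_mul, le_div_iff₀ htpos]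
      linarith
    intro w
    refine le_antisymm ?_ (hle w)
    have := hle (-w)
    rw [map_neg, inner_neg_right] at this
    linarith
  rw [Metric.continuousWithinAt_iff]
  intro ε hε
  have hlo := (hasFDerivAt_iff_isLittleO.1 hf).def (by positivity : (0 : ℝ) < ε / 4)
  obtain ⟨δ, hδ, hb⟩ := Metric.eventually_nhds_iff.1 (hlo.and (hD.mem_nhds hx))
  refine ⟨δ / 2, by linarith, fun {y} hy hyx => ?_⟩
  rcases eq_or_ne (p y) (p x) with h0 | h0
  · rw [h0, dist_self]; exact hε
  rcases eq_or_ne y x with h1 | h1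
  · rw [h1, dist_self]; exact hε
  have hq : 0 < ‖p y - p x‖ := norm_pos_iff.2 (sub_ne_zero.2 h0)
  have hu : 0 < ‖y - x‖ := norm_pos_iff.2 (sub_ne_zero.2 h1)
  -- The test point `y + k` lies in the direction where the two subgradients differ most. The
  -- subgradient at `y` and differentiability at `x` bound `f (y + k)` from opposite sides.
  set k := (‖y - x‖ / ‖p y - p x‖) • (p y - p x) with hk
  have hkn : ‖k‖ = ‖y - x‖ := by
    rw [hk, norm_smul, norm_div, norm_norm, norm_norm, div_mul_cancel₀ _ hq.ne']
  have hki : ⟪p y - p x, k⟫_ℝ = ‖y - x‖ * ‖p y - p x‖ := by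
    rw [hk, inner_smul_right, real_inner_self_eq_norm_sq]; field_simp
  have hyk : ‖y + k - x‖ ≤ 2 * ‖y - x‖ := by
    have : y + k - x = (y - x) + k := by abel
    rw [this]; refine (norm_add_le _ _).trans ?_
    rw [hkn]; linarith
  rw [dist_eq_norm] at hyx
  have hb1 := hb (y := y + k) (by rw [dist_eq_norm]; linarith)
  have h2 := hsub y hy _ hb1.2
  have h3 := hsub x hx y hy
  have h4 := (abs_le.1 hb1.1).2
  rw [hp] at h4
  have h5 : ⟪p x, y + k - x⟫_ℝ = ⟪p x, y - x⟫_ℝ + ⟪p x, k⟫_ℝ := by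
    rw [← inner_add_right]; congr 1; abel
  rw [add_sub_cancel_left] at h2
  have h6 : ‖y - x‖ * ‖p y - p x‖ ≤ ‖y - x‖ * (ε / 2) := by
    rw [← hki, inner_sub_left]
    nlinarith
  rw [dist_eq_norm]
  have := le_of_mul_le_mul_left h6 hu
  linarith

variable [FiniteDimensional ℝ H] [MeasurableSpace H] [BorelSpace H]

theorem LipschitzOnWith.volume_image_eq_zero {K : NNReal} {J : H → H} {s : Set H}
    (hJ : LipschitzOnWith K J s) (hs : volume s = 0) : volume (J '' s) = 0 := by
  rw [← InnerProductSpace.euclideanHausdorffMeasure_eq_volume] at hs ⊢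
  have := hJ.euclideanHausdorffMeasure_image_le (Module.finrank ℝ H)
  rwa [hs, mul_zero, nonpos_iff_eq_zero] at this

/-- Second order differentiability from above of convex functions almost everywhere. -/
theorem volume_not_hasQuadraticUpperBound {f : H → ℝ} {p : H → H} {D : Set H} {L : NNReal}
    (hD : IsOpen D) (hsub : ∀ x ∈ D, ∀ y ∈ D, f x + ⟪p x, y - x⟫_ℝ ≤ f y)
    (hLip : LipschitzOnWith L f D) :
    volume {x ∈ D | ¬ HasQuadraticUpperBound f p D x} = 0 := by
  -- Minty's trick: `p` is monotone, so `Φ` does not decrease distances and its inverse `J` is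
  -- 1-Lipschitz on `Z`. By Rademacher and the Sard-type null-image lemma, `J` has an invertible
  -- derivative within `Z` at `Φ x` for almost every `x`.
  set Φ : H → H := fun h => h + p h with hΦ
  have hmono : ∀ x ∈ D, ∀ y ∈ D, ‖x - y‖ ≤ ‖Φ x - Φ y‖ := by
    intro x hx y hy
    have h1 := hsub x hx y hy
    have h2 := hsub y hy x hx
    rw [← neg_sub x y, inner_neg_right] at h1
    have h3 : 0 ≤ ⟪x - y, p x - p y⟫_ℝ := by
      rw [real_inner_comm, inner_sub_left]; linarith
    have h4 : Φ x - Φ y = (x - y) + (p x - p y) := by simp only [hΦ]; abel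
    have h5 : ‖x - y‖ ^ 2 ≤ ‖Φ x - Φ y‖ ^ 2 := by
      rw [h4, norm_add_sq_real]; nlinarith [sq_nonneg ‖p x - p y‖]
    exact (sq_le_sq₀ (norm_nonneg _) (norm_nonneg _)).1 h5
  have hinj : InjOn Φ D := fun x hx y hy hxy => by
    have := hmono x hx y hy
    rw [hxy, sub_self, norm_zero] at this
    exact sub_eq_zero.1 (norm_eq_zero.1 (le_antisymm this (norm_nonneg _)))
  set J := Function.invFunOn Φ D with hJdef
  have hJ : ∀ x ∈ D, J (Φ x) = x := fun x hx => hinj.leftInvOn_invFunOn hx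
  set Z := Φ '' D with hZ
  have hJL : LipschitzOnWith 1 J Z := by
    refine LipschitzOnWith.of_dist_le_mul ?_
    rintro _ ⟨x, hx, rfl⟩ _ ⟨y, hy, rfl⟩
    rw [hJ x hx, hJ y hy, NNReal.coe_one, one_mul, dist_eq_norm, dist_eq_norm]
    exact hmono x hx y hy
  set Z₁ := {z ∈ Z | ¬ DifferentiableWithinAt ℝ J Z z} with hZ₁
  set Z₂ := {z ∈ Z | DifferentiableWithinAt ℝ J Z z ∧ (fderivWithin ℝ J Z z).det = 0} with hZ₂
  have hZ₁0 : volume (J '' Z₁) = 0 := by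
    refine (hJL.mono fun z hz => hz.1).volume_image_eq_zero ?_
    have := hJL.ae_differentiableWithinAt_of_mem (μ := volume)
    rw [ae_iff] at this
    refine measure_mono_null (fun z hz => ?_) this
    simp only [mem_ofPred_eq, Classical.not_imp]
    exact hz
  have hZ₂0 : volume (J '' Z₂) = 0 :=
    addHaar_image_eq_zero_of_det_fderivWithin_eq_zero volume
      (fun z hz => hz.2.1.hasFDerivWithinAt.mono fun z hz => hz.1) fun z hz => hz.2.2
  have hD₁ : volume {x ∈ D | ¬ DifferentiableAt ℝ f x} = 0 := by
    have := hLip.ae_differentiableWithinAt_of_mem (μ := volume)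
    rw [ae_iff] at this
    refine measure_mono_null (fun x hx => ?_) this
    simp only [mem_ofPred_eq, Classical.not_imp]
    exact ⟨hx.1, fun h => hx.2 (h.differentiableAt (hD.mem_nhds hx.1))⟩
  refine measure_mono_null ?_ (measure_union_null (measure_union_null hZ₁0 hZ₂0) hD₁)
  rintro x ⟨hx, hnot⟩
  by_contra hgood
  apply hnot
  have hz : Φ x ∈ Z := ⟨x, hx, rfl⟩
  have hdf : DifferentiableAt ℝ f x := by
    by_contra h; exact hgood (Or.inr ⟨hx, h⟩)
  have hdJ : DifferentiableWithinAt ℝ J Z (Φ x) := by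
    by_contra h; exact hgood (Or.inl (Or.inl ⟨Φ x, ⟨hz, h⟩, hJ x hx⟩))
  have hdet : (fderivWithin ℝ J Z (Φ x)).det ≠ 0 := by
    intro h; exact hgood (Or.inl (Or.inr ⟨Φ x, ⟨hz, hdJ, h⟩, hJ x hx⟩))
  have hpc := continuousWithinAt_subgradient hD hsub hx hdf.hasFDerivAt
  have hΦc : ContinuousWithinAt Φ D x := continuousWithinAt_id.add hpc
  set A := (fderivWithin ℝ J Z (Φ x)).toContinuousLinearEquivOfDetNeZero hdet with hA
  obtain ⟨c, hc, hAc⟩ : ∃ c : ℝ, 0 < c ∧ ∀ w, c * ‖w‖ ≤ ‖fderivWithin ℝ J Z (Φ x) w‖ := by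
    refine ⟨(‖(A.symm : H →L[ℝ] H)‖ + 1)⁻¹, by positivity, fun w => ?_⟩
    rw [inv_mul_le_iff₀ (by positivity)]
    have h1 : (A.symm : H →L[ℝ] H) (fderivWithin ℝ J Z (Φ x) w) = w := A.symm_apply_apply w
    have h2 := (A.symm : H →L[ℝ] H).le_opNorm (fderivWithin ℝ J Z (Φ x) w)
    rw [h1] at h2
    linarith [norm_nonneg (fderivWithin ℝ J Z (Φ x) w)]
  have hlo := (hasFDerivWithinAt_iff_isLittleO.1 hdJ.hasFDerivWithinAt).def (half_pos hc)
  have htend : Tendsto Φ (𝓝[D] x) (𝓝[Z] (Φ x)) :=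
    hΦc.tendsto_nhdsWithin (mapsTo_image Φ D)
  have hev := htend.eventually hlo
  obtain ⟨r, hr, hb⟩ := Metric.mem_nhdsWithin_iff.1 hev
  -- Invertibility of the derivative of `J` turns into the pointwise bound `‖Φ y - Φ x‖ ≤ (2 / c) ‖y
  -- - x‖`; the extra `1` accounts for the identity in `Φ`.
  refine ⟨2 / c + 1, r, hr, by positivity, fun y hy hyr => ?_⟩
  have h1 : ‖J (Φ y) - J (Φ x) - fderivWithin ℝ J Z (Φ x) (Φ y - Φ x)‖ ≤ c / 2 * ‖Φ y - Φ x‖ :=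
    hb ⟨by rwa [mem_ball, dist_eq_norm], hy⟩
  rw [hJ y hy, hJ x hx] at h1
  have h2 := hAc (Φ y - Φ x)
  have h3 := norm_sub_norm_le (fderivWithin ℝ J Z (Φ x) (Φ y - Φ x)) (y - x)
  rw [norm_sub_rev (fderivWithin ℝ J Z (Φ x) (Φ y - Φ x)) (y - x)] at h3
  have h4 : c / 2 * ‖Φ y - Φ x‖ ≤ ‖y - x‖ := by linarith
  have h5 : ‖Φ y - Φ x‖ ≤ 2 / c * ‖y - x‖ := by
    rw [div_mul_eq_mul_div, le_div_iff₀ hc]; linarith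
  have h6 : ‖p y - p x‖ ≤ (2 / c + 1) * ‖y - x‖ := by
    have : p y - p x = (Φ y - Φ x) - (y - x) := by simp only [hΦ]; abel
    rw [this]
    refine (norm_sub_le _ _).trans ?_
    linarith
  have h7 := hsub y hy x hx
  have h8 : ⟪p y, x - y⟫_ℝ = -⟪p y - p x, y - x⟫_ℝ - ⟪p x, y - x⟫_ℝ := by
    rw [← neg_sub y x, inner_neg_right, inner_sub_left]; ring
  have h9 := real_inner_le_norm (p y - p x) (y - x)
  nlinarith [mul_le_mul_of_nonneg_right h6 (norm_nonneg (y - x))]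

end SecondOrder

/-! ### From quadratic bounds to touching balls. -/

section TouchingBalls

variable {E : Type*} [NormedAddCommGroup E] [InnerProductSpace ℝ E]

/-- The ball is shrunk by a homothety centred at `x`. -/
theorem TouchedByBall.mono {W : Set E} {x : E} {r ρ : ℝ} (h : TouchedByBall W ρ x) (hr : 0 ≤ r)
    (hrρ : r ≤ ρ) : TouchedByBall W r x := by
  obtain ⟨c, hc, hx⟩ := h
  rcases hr.eq_or_lt with rfl | hr
  · exact ⟨x, by simpa using hc hx, by simp⟩
  have hρ : 0 < ρ := hr.trans_le hrρ
  rw [mem_closedBall, dist_eq_norm] at hx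
  have hxc : x - (x + (r / ρ) • (c - x)) = (r / ρ) • (x - c) := by
    rw [← neg_sub x c, smul_neg]; abel
  refine ⟨x + (r / ρ) • (c - x), (closedBall_subset_closedBall' ?_).trans hc, ?_⟩
  · have : x + (r / ρ) • (c - x) - c = (1 - r / ρ) • (x - c) := by
      rw [sub_smul, one_smul, ← neg_sub x c, smul_neg]; abel
    have h1 : 0 ≤ 1 - r / ρ := by rw [sub_nonneg, div_le_one hρ]; exact hrρ
    rw [dist_eq_norm, this, norm_smul, Real.norm_eq_abs, abs_of_nonneg h1]
    have := mul_le_mul_of_nonneg_left hx h1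
    have h2 : r / ρ * ρ = r := by field_simp
    nlinarith
  · rw [mem_closedBall, dist_eq_norm, hxc, norm_smul, Real.norm_eq_abs,
      abs_of_pos (div_pos hr hρ), div_mul_eq_mul_div, div_le_iff₀ hρ]
    exact mul_le_mul_of_nonneg_left hx hr.le

theorem GraphChart.exists_touchedByBall {W : Set E} (G : GraphChart W) {h : orthHyperplane G.e}
    (hh : h ∈ ball G.center G.radius) {ν : E} (hν : IsNormalAt W (G.graph h) ν) (h1 : ‖ν‖ = 1)
    {p : orthHyperplane G.e → orthHyperplane G.e} (hp : p h = G.slope ν)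
    (hq : HasQuadraticUpperBound G.f p (ball G.center G.radius) h) :
    ∃ ρ > 0, TouchedByBall W ρ (G.graph h) := by
  obtain ⟨C, r, hr, hC, hb⟩ := hq
  have hs := G.le_neg_inner hh hν h1
  have hs1 := G.neg_inner_le h1
  have hκ := G.κ_pos
  set s := -⟪ν, G.e⟫_ℝ with hs_def
  have hspos : 0 < s := hκ.trans_le hs
  set x := G.graph h with hx
  obtain ⟨δ, hδ, hU⟩ := Metric.isOpen_iff.1 G.isOpen_U x (G.graph_mem hh).2
  -- Points of the ball are within `2ρ` of `x`. The first two bounds keep them in the chart and in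
  -- the range of the paraboloid; the third gives `2ρsC ≤ 1`, so the ball lies above the paraboloid.
  set ρ := min (min (δ / 4) (r / 4)) (1 / (2 * (C + 1))) with hρ_def
  have hρ : 0 < ρ := by positivity
  have hρδ : ρ ≤ δ / 4 := (min_le_left _ _).trans (min_le_left _ _)
  have hρr : ρ ≤ r / 4 := (min_le_left _ _).trans (min_le_right _ _)
  have hρC : ρ * (2 * (C + 1)) ≤ 1 := by
    rw [← le_div_iff₀ (by positivity)]; exact min_le_right _ _
  refine ⟨ρ, hρ, x - ρ • ν, fun q hq => ?_, ?_⟩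
  · obtain ⟨k, hk⟩ : ∃ k, k = q - x := ⟨_, rfl⟩
    have hqk : q = x + k := by rw [hk]; abel
    rw [mem_closedBall, dist_eq_norm] at hq
    have e1 : q - (x - ρ • ν) = k + ρ • ν := by rw [hk]; abel
    rw [e1] at hq
    have hρν : ‖ρ • ν‖ = ρ := by rw [norm_smul, h1, mul_one, Real.norm_eq_abs, abs_of_pos hρ]
    have hk2 : ‖k‖ ≤ 2 * ρ := by
      have := norm_sub_le (k + ρ • ν) (ρ • ν)
      rw [add_sub_cancel_right, hρν] at this
      linarith
    have hsq : ‖k‖ ^ 2 ≤ -(2 * ρ * ⟪k, ν⟫_ℝ) := by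
      have : ‖k + ρ • ν‖ ^ 2 ≤ ρ ^ 2 := by gcongr
      rw [norm_add_sq_real, hρν, inner_smul_right] at this
      linarith
    have hqU : q ∈ G.U := by
      apply hU
      rw [mem_ball, dist_eq_norm, ← hk]; linarith
    have hxp : hypProj G.e x = h := hypProj_graph G.norm_e h _
    have hqp : hypProj G.e q - h = hypProj G.e k := by rw [hqk, map_add, hxp]; abel
    have hkn : ‖hypProj G.e k‖ ≤ ‖k‖ := norm_hypProj_le k
    apply G.mem_of_le q hqU
    have h2 := hb (hypProj G.e q) (G.hypProj_mem q hqU) (by rw [hqp]; linarith)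
    refine h2.trans ?_
    rw [hqp, hp]
    have h3 : ⟪G.e, q⟫_ℝ = G.f h + ⟪G.e, k⟫_ℝ := by
      rw [hqk, inner_add_right, hx, GraphChart.graph, inner_graph G.norm_e]
    have h4 : ⟪k, ν⟫_ℝ = s * ⟪G.slope ν, hypProj G.e k⟫_ℝ - s * ⟪G.e, k⟫_ℝ := by
      conv_lhs => rw [real_inner_comm, ← hypProj_add_smul G.norm_e k]
      rw [inner_add_right, inner_smul_right, inner_coe_eq_inner_hypProj, GraphChart.slope,
        real_inner_smul_left, ← hs_def, mul_inv_cancel_left₀ hspos.ne', hs_def]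
      ring
    rw [h3]
    have h5 : ‖k‖ ^ 2 ≤ 2 * ρ * s * (⟪G.e, k⟫_ℝ - ⟪G.slope ν, hypProj G.e k⟫_ℝ) := by
      rw [h4] at hsq; linarith
    have h6 : ‖hypProj G.e k‖ ^ 2 ≤ ‖k‖ ^ 2 := by gcongr
    have h7 : 2 * ρ * s * (C * ‖hypProj G.e k‖ ^ 2) ≤ ‖hypProj G.e k‖ ^ 2 := by
      have : 2 * ρ * s * C ≤ 1 := by
        have : 2 * ρ * C * s ≤ 2 * ρ * C * 1 := by gcongr
        nlinarith
      nlinarith [sq_nonneg ‖hypProj G.e k‖]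
    have h8 := le_of_mul_le_mul_left (h7.trans (h6.trans h5)) (by positivity)
    linarith
  · rw [mem_closedBall, dist_eq_norm, sub_sub_cancel, norm_smul, h1, mul_one, Real.norm_eq_abs,
      abs_of_pos hρ]

end TouchingBalls

/-! ### Local measure of the frontier. -/

section FrontierMeasure

variable {n : ℕ} {W : Set (EuclideanSpace ℝ (Fin n))}

theorem finrank_orthHyperplane {e : EuclideanSpace ℝ (Fin n)} (he : ‖e‖ = 1) :
    Module.finrank ℝ (orthHyperplane e) = n - 1 := by
  have h0 : e ≠ 0 := by rintro rfl; simp at he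
  have h1 := Submodule.finrank_add_finrank_orthogonal (Submodule.span ℝ {e})
  rw [finrank_span_singleton h0, finrank_euclideanSpace_fin] at h1
  change Module.finrank ℝ (Submodule.span ℝ {e})ᗮ = _
  omega

theorem GraphChart.μHE_eq_volume (G : GraphChart W) :
    (μHE[n - 1] : Measure (orthHyperplane G.e)) = volume := by
  rw [← finrank_orthHyperplane G.norm_e, InnerProductSpace.euclideanHausdorffMeasure_eq_volume]

/-- Almost every frontier point of a convex body is touched by a ball contained in the body. -/
theorem IsConvexBodyUnbdd.measure_not_touchedByBall (hW : IsConvexBodyUnbdd W) :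
    μHE[n - 1] {x ∈ frontier W | ¬ ∃ ρ > 0, TouchedByBall W ρ x} = 0 := by
  refine measure_null_of_locally_null _ fun x₀ hx₀ => ?_
  obtain ⟨G, hxG⟩ := exists_graphChart hW.isClosed hW.convex hW.interior_nonempty hx₀.1
  refine ⟨_, inter_mem_nhdsWithin _ (G.isOpen_U.mem_nhds hxG), ?_⟩
  have hex : ∀ h : orthHyperplane G.e, ∃ ν, h ∈ ball G.center G.radius →
      ‖ν‖ = 1 ∧ IsNormalAt W (G.graph h) ν := by
    intro h
    by_cases hh : h ∈ ball G.center G.radius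
    · obtain ⟨ν, h1, h2⟩ := exists_isNormalAt hW.convex hW.interior_nonempty (G.graph_mem hh).1
      exact ⟨ν, fun _ => ⟨h1, h2⟩⟩
    · exact ⟨0, fun h' => absurd h' hh⟩
  choose ν hν using hex
  have hκ := G.κ_pos
  have hLf : LipschitzOnWith G.κ⁻¹.toNNReal G.f (ball G.center G.radius) := by
    refine LipschitzOnWith.of_dist_le_mul fun x hx y hy => ?_
    rw [Real.coe_toNNReal _ (by positivity), Real.dist_eq, dist_eq_norm]
    exact G.abs_f_sub_le hW.isClosed hW.convex hW.interior_nonempty hx hy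
  have hnull := volume_not_hasQuadraticUpperBound (p := fun h => G.slope (ν h)) isOpen_ball
    (fun x hx y hy => G.add_inner_slope_le hW.isClosed hx hy (hν x hx).2 (hν x hx).1) hLf
  have hLip := G.lipschitzOnWith_graph hW.isClosed hW.convex hW.interior_nonempty
  have himg := (hLip.mono (fun x hx => hx.1 : {x ∈ ball G.center G.radius |
    ¬ HasQuadraticUpperBound G.f (fun h => G.slope (ν h)) (ball G.center G.radius) x} ⊆
      ball G.center G.radius)).euclideanHausdorffMeasure_image_le (n - 1)
  rw [G.μHE_eq_volume, hnull, mul_zero, nonpos_iff_eq_zero] at himg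
  refine measure_mono_null ?_ himg
  rintro x ⟨⟨hx, hnt⟩, hxU⟩
  have hh := G.hypProj_mem x hxU
  have hgx := G.graph_hypProj ⟨hx, hxU⟩
  refine ⟨hypProj G.e x, ⟨hh, fun hq => hnt ?_⟩, hgx⟩
  rw [← hgx]
  exact G.exists_touchedByBall hh (hν _ hh).2 (hν _ hh).1 rfl hq

theorem IsConvexBodyUnbdd.measure_frontier_inter_lt_top (hW : IsConvexBodyUnbdd W)
    {K : Set (EuclideanSpace ℝ (Fin n))} (hK : IsCompact K) :
    μHE[n - 1] (frontier W ∩ K) < ⊤ := by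
  refine (hK.inter_left isClosed_frontier).measure_lt_top_of_nhdsWithin fun x₀ hx₀ => ?_
  obtain ⟨G, hxG⟩ := exists_graphChart hW.isClosed hW.convex hW.interior_nonempty hx₀.1
  refine ⟨_, inter_mem_nhdsWithin _ (G.isOpen_U.mem_nhds hxG), ?_⟩
  have hLip := G.lipschitzOnWith_graph hW.isClosed hW.convex hW.interior_nonempty
  have himg := hLip.euclideanHausdorffMeasure_image_le (n - 1)
  rw [G.μHE_eq_volume] at himg
  refine (measure_mono ?_).trans_lt (himg.trans_lt ?_)
  · rintro x ⟨⟨hx, -⟩, hxU⟩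
    exact ⟨hypProj G.e x, G.hypProj_mem x hxU, G.graph_hypProj ⟨hx, hxU⟩⟩
  · exact ENNReal.mul_lt_top (by simp) measure_ball_lt_top

theorem IsConvexBodyUnbdd.measure_frontier_inter_pos (hW : IsConvexBodyUnbdd W)
    {V : Set (EuclideanSpace ℝ (Fin n))} (hV : IsOpen V) {x₀ : EuclideanSpace ℝ (Fin n)}
    (hx₀ : x₀ ∈ frontier W) (hx₀V : x₀ ∈ V) : 0 < μHE[n - 1] (frontier W ∩ V) := by
  obtain ⟨G, hxG⟩ := exists_graphChart hW.isClosed hW.convex hW.interior_nonempty hx₀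
  have hLip := G.lipschitzOnWith_graph hW.isClosed hW.convex hW.interior_nonempty
  set D := ball G.center G.radius ∩ G.graph ⁻¹' V with hD
  have hDo : IsOpen D := hLip.continuousOn.isOpen_inter_preimage isOpen_ball hV
  have hDne : D.Nonempty := ⟨hypProj G.e x₀, G.hypProj_mem x₀ hxG, by
    rw [mem_preimage, G.graph_hypProj ⟨hx₀, hxG⟩]; exact hx₀V⟩
  have hpos : 0 < μHE[n - 1] D := by
    rw [G.μHE_eq_volume]; exact hDo.measure_pos _ hDne
  refine hpos.trans_le ((euclideanHausdorffMeasure_le_image (f := G.graph) _ ?_).trans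
    (measure_mono ?_))
  · intro x hx y hy
    rw [edist_dist, edist_dist]
    apply ENNReal.ofReal_le_ofReal
    rw [dist_eq_norm, dist_eq_norm]
    have := norm_hypProj_le (e := G.e) (G.graph x - G.graph y)
    rwa [map_sub, GraphChart.graph, GraphChart.graph, hypProj_graph G.norm_e,
      hypProj_graph G.norm_e] at this
  · rintro _ ⟨h, hh, rfl⟩
    exact ⟨(G.graph_mem hh.1).1, hh.2⟩

end FrontierMeasure

/-! ### Asymptotic cones and height functions. -/

section Lines

variable {E : Type*} [NormedAddCommGroup E] [InnerProductSpace ℝ E]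

theorem add_smul_mem_of_mem_asymptoticCone {W : Set E} (hconv : Convex ℝ W) (hcl : IsClosed W)
    {d x : E} (hd : d ∈ asymptoticCone ℝ W) (hx : x ∈ W) {t : ℝ} (ht : 0 ≤ t) : x + t • d ∈ W := by
  have := hconv.smul_vadd_mem_of_isClosed_of_mem_asymptoticCone hcl ht hd hx
  rwa [vadd_eq_add, add_comm] at this

theorem mem_asymptoticCone_of_ray {W : Set E} {p d : E} (h : ∀ t : ℝ, 0 ≤ t → p + t • d ∈ W) :
    d ∈ asymptoticCone ℝ W := by
  have h1 : Tendsto (fun t : ℝ => t • d +ᵥ p) atTop (AffineSpace.asymptoticNhds ℝ E d) :=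
    (tendsto_id.atTop_smul_const_tendsto_asymptoticNhds d).asymptoticNhds_vadd_const p
  refine h1.frequently (Eventually.frequently ?_)
  filter_upwards [eventually_ge_atTop 0] with t ht
  rw [vadd_eq_add, add_comm]
  exact h t ht

theorem containsLine_of_forall_mem {n : ℕ} {A : Set (EuclideanSpace ℝ (Fin n))}
    {p d : EuclideanSpace ℝ (Fin n)} (hd : d ≠ 0) (h : ∀ t : ℝ, p + t • d ∈ A) :
    ContainsLine A := by
  have hn : ‖d‖ ≠ 0 := norm_ne_zero_iff.2 hd
  refine ⟨fun t => p + (t / ‖d‖) • d, Isometry.of_dist_eq fun s t => ?_, ?_⟩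
  · rw [dist_add_left, dist_eq_norm, ← sub_smul, norm_smul, ← sub_div, norm_div, norm_norm,
      div_mul_cancel₀ _ hn, Real.dist_eq, Real.norm_eq_abs]
  · rintro _ ⟨t, rfl⟩
    exact h _

variable [FiniteDimensional ℝ E]

/-- A closed convex set whose asymptotic cone is pointed has a linear functional with bounded
sublevel sets. -/
theorem exists_bounded_sublevels {W : Set E} (hconv : Convex ℝ W) (hcl : IsClosed W)
    (hpt : ∀ d ∈ asymptoticCone ℝ W, -d ∈ asymptoticCone ℝ W → d = 0) :
    ∃ v : E, ∀ t : ℝ, Bornology.IsBounded {x ∈ W | ⟪v, x⟫_ℝ ≤ t} := by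
  have hKcl : IsClosed (asymptoticCone ℝ W) := isClosed_asymptoticCone
  have hKconv : Convex ℝ (asymptoticCone ℝ W) := hconv.asymptoticCone
  have hsep : ∀ d ∈ asymptoticCone ℝ W, d ≠ 0 →
      ∃ v : E, (∀ b ∈ asymptoticCone ℝ W, 0 ≤ ⟪v, b⟫_ℝ) ∧ 0 < ⟪v, d⟫_ℝ := by
    intro d hd hd0
    have hnd : -d ∉ asymptoticCone ℝ W := fun h => hd0 (hpt d hd h)
    obtain ⟨f, u, hfu, hub⟩ := geometric_hahn_banach_point_closed hKconv hKcl hnd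
    have hf : ∀ y, ⟪(InnerProductSpace.toDual ℝ E).symm f, y⟫_ℝ = f y :=
      fun y => InnerProductSpace.toDual_symm_apply
    have h0 : (0 : E) ∈ asymptoticCone ℝ W := by
      simpa using smul_mem_asymptoticCone le_rfl hd
    have hu0 : u < 0 := by simpa using hub 0 h0
    refine ⟨(InnerProductSpace.toDual ℝ E).symm f, fun b hb => ?_, ?_⟩
    · rw [hf]
      by_contra! hneg
      have h1 := hub _ (smul_mem_asymptoticCone (div_nonneg_of_nonpos hu0.le hneg.le) hb)
      rw [map_smul, smul_eq_mul, div_mul_cancel₀ _ hneg.ne] at h1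
      exact lt_irrefl _ h1
    · rw [hf]
      rw [map_neg] at hfu
      linarith
  have hcomp : IsCompact (asymptoticCone ℝ W ∩ sphere 0 1) := (isCompact_sphere 0 1).inter_left hKcl
  obtain ⟨v, hv, hvpos⟩ : ∃ v : E, (∀ b ∈ asymptoticCone ℝ W, 0 ≤ ⟪v, b⟫_ℝ) ∧
      ∀ x ∈ asymptoticCone ℝ W ∩ sphere 0 1, x ∈ asymptoticCone ℝ W → 0 < ⟪v, x⟫_ℝ := by
    -- Each unit direction of the cone has a functional positive near it and nonnegative on the
    -- cone; compactness permits a finite sum.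
    refine hcomp.induction_on (p := fun s => ∃ v : E, (∀ b ∈ asymptoticCone ℝ W, 0 ≤ ⟪v, b⟫_ℝ) ∧
      ∀ x ∈ s, x ∈ asymptoticCone ℝ W → 0 < ⟪v, x⟫_ℝ) ?_ ?_ ?_ ?_
    · exact ⟨0, by simp, by simp⟩
    · rintro s t hst ⟨v, h1, h2⟩
      exact ⟨v, h1, fun x hx => h2 x (hst hx)⟩
    · rintro s t ⟨v, h1, h2⟩ ⟨w, h3, h4⟩
      refine ⟨v + w, fun b hb => ?_, fun x hx hxK => ?_⟩
      · rw [inner_add_left]; exact add_nonneg (h1 b hb) (h3 b hb)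
      · rw [inner_add_left]
        rcases hx with hx | hx
        · exact add_pos_of_pos_of_nonneg (h2 x hx hxK) (h3 x hxK)
        · exact add_pos_of_nonneg_of_pos (h1 x hxK) (h4 x hx hxK)
    · rintro x ⟨hxK, hx1⟩
      have hx0 : x ≠ 0 := by rintro rfl; simp at hx1
      obtain ⟨v, h1, h2⟩ := hsep x hxK hx0
      refine ⟨{y | 0 < ⟪v, y⟫_ℝ}, mem_nhdsWithin_of_mem_nhds ?_, v, h1, fun y hy _ => hy⟩
      have ho : IsOpen {y : E | 0 < ⟪v, y⟫_ℝ} := isOpen_lt continuous_const (by fun_prop)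
      exact ho.mem_nhds h2
  refine ⟨v, fun t => ?_⟩
  rcases ({x ∈ W | ⟪v, x⟫_ℝ ≤ t}).eq_empty_or_nonempty with h | ⟨p, hp⟩
  · rw [h]; exact Bornology.isBounded_empty
  rw [isBounded_iff_asymptoticCone_subset_singleton]
  intro u hu
  have hSconv : Convex ℝ {x ∈ W | ⟪v, x⟫_ℝ ≤ t} :=
    hconv.inter ((convex_Iic t).linear_preimage (innerSL ℝ v).toLinearMap)
  have hhalf : IsClosed {x : E | ⟪v, x⟫_ℝ ≤ t} := isClosed_le (by fun_prop) continuous_const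
  have hScl : IsClosed {x ∈ W | ⟪v, x⟫_ℝ ≤ t} := hcl.inter hhalf
  have huK : u ∈ asymptoticCone ℝ W := asymptoticCone_mono (fun x hx => hx.1) hu
  by_contra hu0
  rw [mem_singleton_iff] at hu0
  have hn : 0 < ‖u‖ := norm_pos_iff.2 hu0
  have hmem := smul_mem_asymptoticCone (inv_nonneg.2 hn.le) huK
  have hpos := hvpos (‖u‖⁻¹ • u) ⟨hmem, by
    rw [mem_sphere_zero_iff_norm, norm_smul, norm_inv, norm_norm, inv_mul_cancel₀ hn.ne']⟩ hmem
  rw [inner_smul_right] at hpos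
  have hvu : 0 < ⟪v, u⟫_ℝ := (mul_pos_iff_of_pos_left (inv_pos.2 hn)).1 hpos
  -- Moving this far from `p` along `u` reaches the value `t + 1`, outside the sublevel set.
  have hcge : 0 ≤ (t - ⟪v, p⟫_ℝ + 1) / ⟪v, u⟫_ℝ :=
    div_nonneg (by have := hp.2; linarith) hvu.le
  have h2 := (add_smul_mem_of_mem_asymptoticCone hSconv hScl hu hp hcge).2
  rw [inner_add_right, inner_smul_right, div_mul_cancel₀ _ hvu.ne'] at h2
  linarith

/-- A line-free closed convex set has a nonnegative height function with bounded sublevels. -/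
theorem exists_height {W : Set E} (hconv : Convex ℝ W) (hcl : IsClosed W)
    (hpt : ∀ d ∈ asymptoticCone ℝ W, -d ∈ asymptoticCone ℝ W → d = 0) :
    ∃ (v : E) (β : ℝ), ‖v‖ ≤ 1 ∧ (∀ x ∈ W, 0 ≤ ⟪v, x⟫_ℝ + β) ∧
      ∀ t : ℝ, Bornology.IsBounded {x ∈ W | ⟪v, x⟫_ℝ + β ≤ t} := by
  obtain ⟨w, hw⟩ := exists_bounded_sublevels hconv hcl hpt
  have hpos : 0 < (‖w‖ + 1)⁻¹ := by positivity
  obtain ⟨v, hv⟩ : ∃ v, v = (‖w‖ + 1)⁻¹ • w := ⟨_, rfl⟩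
  have hbd : ∀ t : ℝ, Bornology.IsBounded {x ∈ W | ⟪v, x⟫_ℝ ≤ t} := by
    intro t
    refine (hw ((‖w‖ + 1) * t)).subset fun x hx => ⟨hx.1, ?_⟩
    have := hx.2
    rwa [hv, real_inner_smul_left, inv_mul_le_iff₀ (by positivity)] at this
  obtain ⟨C, hC⟩ := (hbd 0).exists_norm_le
  have hv1 : ‖v‖ ≤ 1 := by
    rw [hv, norm_smul, norm_inv, Real.norm_eq_abs, abs_of_pos (by positivity),
      inv_mul_le_iff₀ (by positivity)]
    linarith
  -- The functional can be negative only on a set of norm at most `C`, where `‖v‖ ≤ 1` keeps it at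
  -- least `-|C|`.
  refine ⟨v, |C|, hv1, fun x hx => ?_, fun t => ?_⟩
  · rcases le_total 0 ⟪v, x⟫_ℝ with h | h
    · positivity
    · have h1 := hC x ⟨hx, h⟩
      have h2 := (abs_le.1 (abs_real_inner_le_norm v x)).1
      have h3 : ‖v‖ * ‖x‖ ≤ 1 * |C| := by
        gcongr
        exact h1.trans (le_abs_self C)
      linarith
  · exact (hbd (t - |C|)).subset fun x hx => ⟨hx.1, by have := hx.2; linarith⟩

end Lines

/-! ### Comparing new and lost frontier. -/

section ExitPoints

variable {E : Type*} [NormedAddCommGroup E] [InnerProductSpace ℝ E]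

theorem exists_exit_point {W : Set E} (hcl : IsClosed W) {p ν : E} (hp : p ∈ interior W)
    {s : ℝ} (hs : 0 ≤ s) (hsW : p + s • ν ∉ W) : ∃ t : ℝ, 0 < t ∧ p + t • ν ∈ frontier W := by
  by_contra! hno
  have hpre : IsPreconnected ((fun t : ℝ => p + t • ν) '' Icc 0 s) :=
    isPreconnected_Icc.image _ (by fun_prop)
  have hcover : (fun t : ℝ => p + t • ν) '' Icc 0 s ⊆ interior W ∪ Wᶜ := by
    rintro _ ⟨t, ht, rfl⟩
    rcases ht.1.eq_or_lt with rfl | htpos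
    · left; simpa using hp
    · by_cases hW : p + t • ν ∈ W
      · left
        by_contra hni
        exact hno t htpos ⟨subset_closure hW, hni⟩
      · exact Or.inr hW
  obtain ⟨x, -, hx1, hx2⟩ := hpre (interior W) Wᶜ isOpen_interior hcl.isOpen_compl hcover
    ⟨p, ⟨0, ⟨le_rfl, hs⟩, by simp⟩, hp⟩ ⟨_, ⟨s, ⟨hs, le_rfl⟩, rfl⟩, hsW⟩
  exact hx2 (interior_subset hx1)

/-- If `W' ⊆ W` are convex bodies and `W'` is invariant under the asymptotic directions of `W`, the
new part of the frontier of `W'` is not larger than the lost part of the frontier of `W`. -/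
theorem measure_frontier_diff_le {n : ℕ} {W W' : Set (EuclideanSpace ℝ (Fin n))}
    (hcl : IsClosed W) (hW' : IsConvexBodyUnbdd W') (hsub : W' ⊆ W)
    (hinv : ∀ d ∈ asymptoticCone ℝ W, ∀ x ∈ W', x + d ∈ W') :
    μHE[n - 1] (frontier W' \ frontier W) ≤ μHE[n - 1] (frontier W \ frontier W') := by
  have hex : ∀ p : EuclideanSpace ℝ (Fin n), ∃ (ν : EuclideanSpace ℝ (Fin n)) (t : ℝ),
      p ∈ frontier W' \ frontier W →
        IsNormalAt W' p ν ∧ 0 < t ∧ p + t • ν ∈ frontier W \ frontier W' := by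
    intro p
    by_cases hp : p ∈ frontier W' \ frontier W
    · obtain ⟨ν, h1, hν⟩ := exists_isNormalAt hW'.convex hW'.interior_nonempty hp.1
      have hpW' := hW'.isClosed.frontier_subset hp.1
      have hpi : p ∈ interior W := by
        by_contra hni; exact hp.2 ⟨subset_closure (hsub hpW'), hni⟩
      -- A normal ray staying in `W` would make `ν` an asymptotic direction, so `hinv` would put `p
      -- + ν` in `W'`, beyond its own supporting hyperplane.
      have hray : ∃ s : ℝ, 0 ≤ s ∧ p + s • ν ∉ W := by
        by_contra! hall
        have := hν _ (hinv ν (mem_asymptoticCone_of_ray hall) p hpW')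
        rw [add_sub_cancel_left, real_inner_self_eq_norm_sq, h1] at this
        linarith
      obtain ⟨s, hs, hsW⟩ := hray
      obtain ⟨t, ht, htW⟩ := exists_exit_point hcl hpi hs hsW
      refine ⟨ν, t, fun _ => ⟨hν, ht, htW, fun hmem => ?_⟩⟩
      have := hν _ (hW'.isClosed.frontier_subset hmem)
      rw [add_sub_cancel_left, inner_smul_right, real_inner_self_eq_norm_sq, h1] at this
      linarith
    · exact ⟨0, 0, fun h => absurd h hp⟩
  choose ν t hνt using hex
  refine (euclideanHausdorffMeasure_le_image (f := fun p => p + t p • ν p) _ ?_).trans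
    (measure_mono ?_)
  · intro x hx y hy
    obtain ⟨h1, h2, -⟩ := hνt x hx
    obtain ⟨h3, h4, -⟩ := hνt y hy
    have h5 := mul_nonpos_of_nonneg_of_nonpos h2.le (h1 y (hW'.isClosed.frontier_subset hy.1))
    have h6 := mul_nonpos_of_nonneg_of_nonpos h4.le (h3 x (hW'.isClosed.frontier_subset hx.1))
    rw [edist_dist, edist_dist]
    apply ENNReal.ofReal_le_ofReal
    rw [dist_eq_norm, dist_eq_norm]
    have e : x + t x • ν x - (y + t y • ν y) = (x - y) + (t x • ν x - t y • ν y) := by abel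
    -- Monotonicity of outer normals; exit points project back to `x` and `y`, so the exit map
    -- cannot contract.
    have hi : 0 ≤ ⟪x - y, t x • ν x - t y • ν y⟫_ℝ := by
      rw [inner_sub_right, inner_smul_right, inner_smul_right, real_inner_comm (ν x),
        real_inner_comm (ν y)]
      rw [← neg_sub x y, inner_neg_right] at h5
      linarith
    rw [e]
    refine (sq_le_sq₀ (norm_nonneg _) (norm_nonneg _)).1 ?_
    rw [norm_add_sq_real]
    nlinarith [sq_nonneg ‖t x • ν x - t y • ν y‖]
  · rintro _ ⟨p, hp, rfl⟩
    exact (hνt p hp).2.2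

end ExitPoints

/-! ### The union of admissible balls. -/

section RoundedBody

open scoped Pointwise

variable {E : Type*} [NormedAddCommGroup E] [InnerProductSpace ℝ E]

/-- The union of the balls in `W` of radius at most `R` whose radius is at least the
convex function `sup_T a_T (T - ⟪v, c⟫ - β)` of the centre `c`. -/
def roundedBody (W : Set E) (v : E) (β : ℝ) (a : ℕ → ℝ) (R : ℝ) : Set E :=
  {p | ∃ (c : E) (ρ : ℝ), 0 ≤ ρ ∧ ρ ≤ R ∧ (∀ T : ℕ, a T * (T - (⟪v, c⟫_ℝ + β)) ≤ ρ) ∧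
    closedBall c ρ ⊆ W ∧ p ∈ closedBall c ρ}

variable {W : Set E} {v : E} {β : ℝ} {a : ℕ → ℝ} {R : ℝ}

theorem roundedBody_subset : roundedBody W v β a R ⊆ W := by
  rintro p ⟨c, ρ, -, -, -, h, hp⟩
  exact h hp

theorem add_mem_roundedBody (ha : ∀ T, 0 ≤ a T) {d : E} (hd : ∀ x ∈ W, x + d ∈ W)
    (hvd : 0 ≤ ⟪v, d⟫_ℝ) {x : E} (hx : x ∈ roundedBody W v β a R) :
    x + d ∈ roundedBody W v β a R := by
  obtain ⟨c, ρ, h0, hR, hT, hW, hp⟩ := hx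
  refine ⟨c + d, ρ, h0, hR, fun T => ?_, fun q hq => ?_, ?_⟩
  · refine (mul_le_mul_of_nonneg_left ?_ (ha T)).trans (hT T)
    rw [inner_add_right]; linarith
  · have : q - d ∈ closedBall c ρ := by
      rw [mem_closedBall, dist_eq_norm] at hq ⊢
      rwa [sub_sub, add_comm d c]
    simpa using hd _ (hW this)
  · rwa [mem_closedBall, dist_add_right]

variable [FiniteDimensional ℝ E]

/-- The admissible pairs `(c, ρ)` form a convex set, because the lower bound on `ρ` is a supremum of
affine functions of `c`. -/
theorem convex_roundedBody (hconv : Convex ℝ W) : Convex ℝ (roundedBody W v β a R) := by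
  rintro p ⟨c, ρ, h0, hR, hT, hW, hp⟩ p' ⟨c', ρ', h0', hR', hT', hW', hp'⟩ s t hs ht hst
  have hadd : closedBall (s • c + t • c') (s * ρ + t * ρ')
      = s • closedBall c ρ + t • closedBall c' ρ' := by
    rw [smul_closedBall _ _ h0, smul_closedBall _ _ h0', closedBall_add_closedBall (by positivity)
      (by positivity), Real.norm_of_nonneg hs, Real.norm_of_nonneg ht]
  refine ⟨s • c + t • c', s * ρ + t * ρ', by positivity, ?_, fun T => ?_, ?_, ?_⟩
  · calc s * ρ + t * ρ' ≤ s * R + t * R := by gcongr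
      _ = R := by rw [← add_mul, hst, one_mul]
  · rw [inner_add_right, inner_smul_right, inner_smul_right]
    have h1 := mul_le_mul_of_nonneg_left (hT T) hs
    have h2 := mul_le_mul_of_nonneg_left (hT' T) ht
    have ht' : t = 1 - s := by linarith
    subst ht'
    linarith
  · rw [hadd]
    rintro _ ⟨_, ⟨x, hx, rfl⟩, _, ⟨y, hy, rfl⟩, rfl⟩
    exact hconv (hW hx) (hW' hy) hs ht hst
  · rw [hadd]
    exact add_mem_add (smul_mem_smul_set hp) (smul_mem_smul_set hp')

omit [FiniteDimensional ℝ E] in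
theorem closedBall_subset_iff {c : E} {ρ : ℝ} (hρ : 0 ≤ ρ) :
    closedBall c ρ ⊆ W ↔ ∀ w : E, ‖w‖ ≤ 1 → c + ρ • w ∈ W := by
  have : closedBall c ρ = (fun w => c + ρ • w) '' closedBall 0 1 := by
    have := affinity_unitClosedBall (E := E) hρ c
    rw [← this, ← image_smul, ← image_vadd, image_image]; rfl
  rw [this, image_subset_iff]
  exact ⟨fun h w hw => h (by simpa using hw), fun h w hw => h w (by simpa using hw)⟩

/-- The cap `ρ ≤ R` bounds the centres along a convergent sequence, so centres and radii
subconverge. -/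
theorem isClosed_roundedBody (hcl : IsClosed W) : IsClosed (roundedBody W v β a R) := by
  refine IsSeqClosed.isClosed fun x p hx hxp => ?_
  choose c ρ h0 hR hT hW hp using hx
  have hbx : Bornology.IsBounded (range x) := isBounded_range_of_tendsto x hxp
  obtain ⟨M, hM⟩ := hbx.exists_norm_le
  have hc : ∀ k, (c k, ρ k) ∈ closedBall (0 : E) (M + R) ×ˢ Icc 0 R := by
    intro k
    refine ⟨?_, h0 k, hR k⟩
    have h1 := hM _ (mem_range_self k)
    have h2 := hp k
    rw [mem_closedBall, dist_comm, dist_eq_norm] at h2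
    have h3 := norm_sub_norm_le (c k) (x k)
    rw [mem_closedBall_zero_iff]
    linarith [hR k]
  obtain ⟨⟨c₀, ρ₀⟩, hmem, φ, hφ, hlim⟩ :=
    ((isCompact_closedBall (0 : E) (M + R)).prod isCompact_Icc).tendsto_subseq hc
  have hlc : Tendsto (fun k => c (φ k)) atTop (𝓝 c₀) := (continuous_fst.tendsto _).comp hlim
  have hlρ : Tendsto (fun k => ρ (φ k)) atTop (𝓝 ρ₀) := (continuous_snd.tendsto _).comp hlim
  have hlx : Tendsto (fun k => x (φ k)) atTop (𝓝 p) := hxp.comp hφ.tendsto_atTop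
  refine ⟨c₀, ρ₀, hmem.2.1, hmem.2.2, fun T => ?_, ?_, ?_⟩
  · refine le_of_tendsto_of_tendsto' ?_ hlρ fun k => hT (φ k) T
    exact ((((tendsto_const_nhds (x := v)).inner hlc).add_const β).const_sub _).const_mul _
  · rw [closedBall_subset_iff hmem.2.1]
    intro w hw
    refine hcl.mem_of_tendsto (hlc.add (hlρ.smul_const w)) (Eventually.of_forall fun k => ?_)
    exact (closedBall_subset_iff (h0 _)).1 (hW _) w hw
  · rw [mem_closedBall]
    exact le_of_tendsto_of_tendsto' (hlx.dist hlc) hlρ fun k => hp (φ k)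

omit [FiniteDimensional ℝ E] in
/-- Radii of the balls making up the rounded body are locally bounded below. -/
theorem roundedBody_touchedByBall (hv : ‖v‖ ≤ 1) (ha : ∀ T, 0 < a T) (x₀ : E) :
    ∃ r > 0, ∀ᶠ x in 𝓝 x₀, x ∈ roundedBody W v β a R →
      ∃ ρ, r ≤ ρ ∧ TouchedByBall (roundedBody W v β a R) ρ x := by
  -- Centres of balls through points near `x₀` have height below `T - 1`, so the `T`-th constraint
  -- forces `ρ ≥ a T`.
  obtain ⟨T, hT⟩ := exists_nat_gt (⟪v, x₀⟫_ℝ + β + 1 + R + 1)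
  refine ⟨a T, ha T, ?_⟩
  have hc : Continuous fun x : E => ⟪v, x⟫_ℝ := by fun_prop
  have hev : ∀ᶠ x in 𝓝 x₀, ⟪v, x⟫_ℝ < ⟪v, x₀⟫_ℝ + 1 :=
    hc.continuousAt.eventually_lt continuousAt_const (by linarith)
  filter_upwards [hev] with x hx hxW
  obtain ⟨c, ρ, h0, hR, hTρ, hW, hp⟩ := hxW
  refine ⟨ρ, ?_, c, fun q hq => ⟨c, ρ, h0, hR, hTρ, hW, hq⟩, hp⟩
  refine le_trans ?_ (hTρ T)
  rw [mem_closedBall, dist_comm, dist_eq_norm] at hp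
  have h1 : ⟪v, c - x⟫_ℝ ≤ 1 * R :=
    (real_inner_le_norm v (c - x)).trans (by gcongr; exact hp.trans hR)
  rw [inner_sub_right] at h1
  exact le_mul_of_one_le_right (ha T).le (by linarith)

end RoundedBody

/-! ### Rigidity of cylindrical frontiers. -/

section Lines

variable {n : ℕ} {W W' C : Set (EuclideanSpace ℝ (Fin n))} {d : EuclideanSpace ℝ (Fin n)}

/-- Strict convexity of the Euclidean norm makes an isometric copy of `ℝ` affine. -/
theorem ContainsLine.exists_direction {A : Set (EuclideanSpace ℝ (Fin n))} (h : ContainsLine A) :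
    ∃ p d : EuclideanSpace ℝ (Fin n), ‖d‖ = 1 ∧ ∀ t : ℝ, p + t • d ∈ A := by
  obtain ⟨γ, hγ, hA⟩ := h
  set g := hγ.affineIsometryOfStrictConvexSpace with hg
  have hγg : ∀ t, γ t = γ 0 + t • g.linearIsometry 1 := by
    intro t
    have h1 : g (t • (1 : ℝ) +ᵥ (0 : ℝ)) = g.linearIsometry (t • 1) +ᵥ g 0 := g.map_vadd _ _
    rw [map_smul, vadd_eq_add, vadd_eq_add, add_zero, smul_eq_mul, mul_one] at h1
    rw [add_comm]
    exact h1
  refine ⟨γ 0, g.linearIsometry 1, by simp, fun t => ?_⟩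
  rw [← hγg]
  exact hA (mem_range_self t)

theorem IsConvexBodyUnbdd.add_smul_mem (hW : IsConvexBodyUnbdd W) (hd : d ∈ asymptoticCone ℝ W)
    (hd' : -d ∈ asymptoticCone ℝ W) {x : EuclideanSpace ℝ (Fin n)} (hx : x ∈ W) (t : ℝ) :
    x + t • d ∈ W := by
  rcases le_total 0 t with ht | ht
  · exact add_smul_mem_of_mem_asymptoticCone hW.convex hW.isClosed hd hx ht
  · have := add_smul_mem_of_mem_asymptoticCone hW.convex hW.isClosed hd' hx (neg_nonneg.2 ht)
    rwa [smul_neg, neg_smul, neg_neg] at this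

theorem IsConvexBodyUnbdd.add_smul_mem_frontier (hW : IsConvexBodyUnbdd W)
    (hd : d ∈ asymptoticCone ℝ W) (hd' : -d ∈ asymptoticCone ℝ W)
    {x : EuclideanSpace ℝ (Fin n)} (hx : x ∈ frontier W) (t : ℝ) : x + t • d ∈ frontier W := by
  have hpre : (Homeomorph.addRight (t • d)) ⁻¹' W = W := by
    ext y
    refine ⟨fun hy => ?_, fun hy => hW.add_smul_mem hd hd' hy t⟩
    have h1 : y + t • d ∈ W := hy
    have := hW.add_smul_mem hd hd' h1 (-t)
    rwa [neg_smul, add_neg_cancel_right] at this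
  rw [← hpre, ← Homeomorph.preimage_frontier] at hx
  exact hx

theorem mem_asymptoticCone_of_forall_mem {p : EuclideanSpace ℝ (Fin n)}
    (h : ∀ t : ℝ, p + t • d ∈ W) : d ∈ asymptoticCone ℝ W ∧ -d ∈ asymptoticCone ℝ W := by
  refine ⟨mem_asymptoticCone_of_ray fun t _ => h t, mem_asymptoticCone_of_ray (p := p) fun t _ => ?_⟩
  have := h (-t)
  rwa [neg_smul, ← smul_neg] at this

/-- A closed set that misses only a set of finite measure of a cylindrical frontier meets almost
all translates of a piece of the frontier. -/
theorem IsConvexBodyUnbdd.finite_setOf_inter_eq_empty (hW : IsConvexBodyUnbdd W)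
    (hd1 : ‖d‖ = 1) (hd : d ∈ asymptoticCone ℝ W) (hd' : -d ∈ asymptoticCone ℝ W)
    {x₀ : EuclideanSpace ℝ (Fin n)} (hx₀ : x₀ ∈ frontier W) {δ : ℝ} (hδ : 0 < δ) (hδ1 : δ ≤ 1)
    (hC : IsClosed C) (hfin : μHE[n - 1] (frontier W \ C) ≠ ⊤) :
    {k : ℕ | frontier W ∩ ball (x₀ + (3 * ((k : ℝ) + 1)) • d) δ ∩ C = ∅}.Finite := by
  -- Spacing `3` exceeds the diameter `2δ ≤ 2`, so the patches are disjoint; `k + 1` keeps the scale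
  -- nonzero for later division.
  set N : ℕ → Set (EuclideanSpace ℝ (Fin n)) :=
    fun k => frontier W ∩ ball (x₀ + (3 * ((k : ℝ) + 1)) • d) δ with hN
  have hpos : 0 < μHE[n - 1] (frontier W ∩ ball x₀ δ) :=
    hW.measure_frontier_inter_pos isOpen_ball hx₀ (mem_ball_self hδ)
  have hle : ∀ k, μHE[n - 1] (frontier W ∩ ball x₀ δ) ≤ μHE[n - 1] (N k) := by
    intro k
    have hiso : Isometry fun x : EuclideanSpace ℝ (Fin n) => x + (3 * ((k : ℝ) + 1)) • d :=
      isometry_add_right _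
    rw [← hiso.euclideanHausdorffMeasure_image]
    refine measure_mono ?_
    rintro _ ⟨x, ⟨hx, hxb⟩, rfl⟩
    refine ⟨hW.add_smul_mem_frontier hd hd' hx _, ?_⟩
    rwa [mem_ball, dist_add_right]
  have hdisj : Pairwise (Function.onFun Disjoint fun k => N k \ C) := by
    intro j k hjk
    refine (disjoint_left.2 fun x hx hx' => ?_)
    have h1 := hx.1.2
    have h2 := hx'.1.2
    rw [mem_ball] at h1 h2
    have h3 := dist_triangle_left (x₀ + (3 * ((j : ℝ) + 1)) • d) (x₀ + (3 * ((k : ℝ) + 1)) • d) x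
    rw [dist_add_left, dist_eq_norm, ← sub_smul, norm_smul, hd1, mul_one, Real.norm_eq_abs] at h3
    have h4 : (1 : ℝ) ≤ |(j : ℝ) - k| := by
      have : (1 : ℤ) ≤ |(j : ℤ) - k| := by
        apply Int.one_le_abs
        rw [sub_ne_zero]
        exact_mod_cast hjk
      exact_mod_cast this
    have h5 : 3 * ((j : ℝ) + 1) - 3 * ((k : ℝ) + 1) = 3 * ((j : ℝ) - k) := by ring
    rw [h5, abs_mul, abs_of_pos (by norm_num : (0 : ℝ) < 3)] at h3
    linarith
  have hmeas : ∀ k, MeasurableSet (N k \ C) := fun k =>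
    (isClosed_frontier.measurableSet.inter measurableSet_ball).diff hC.measurableSet
  have hun : μHE[n - 1] (⋃ k, N k \ C) ≠ ⊤ := by
    refine ne_top_of_le_ne_top hfin (measure_mono ?_)
    exact iUnion_subset fun k => sdiff_subset_sdiff_left inter_subset_left
  refine (Measure.finite_const_le_meas_of_disjoint_iUnion _ hpos hmeas hdisj hun).subset ?_
  intro k hk
  have hk : N k ∩ C = ∅ := hk
  have : N k \ C = N k := sdiff_eq_left.2 (disjoint_iff_inter_eq_empty.2 hk)
  change _ ≤ μHE[n - 1] (N k \ C)
  rw [this]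
  exact hle k

/-- For all large `k`, `W'` has a point within `1` of `x₀ + 3(k + 1)d`; rescaling these points gives
the direction `d`. -/
theorem IsConvexBodyUnbdd.mem_asymptoticCone_of_measure_ne_top (hW : IsConvexBodyUnbdd W)
    (hd1 : ‖d‖ = 1) (hd : d ∈ asymptoticCone ℝ W) (hd' : -d ∈ asymptoticCone ℝ W)
    (hne : (frontier W).Nonempty) (hW' : IsClosed W')
    (hfin : μHE[n - 1] (frontier W \ frontier W') ≠ ⊤) : d ∈ asymptoticCone ℝ W' := by
  obtain ⟨x₀, hx₀⟩ := hne
  have hf := hW.finite_setOf_inter_eq_empty hd1 hd hd' hx₀ one_pos le_rfl isClosed_frontier hfin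
  have hev : ∀ᶠ k : ℕ in atTop,
      (frontier W ∩ ball (x₀ + (3 * ((k : ℝ) + 1)) • d) 1 ∩ frontier W').Nonempty := by
    obtain ⟨K, hK⟩ := hf.bddAbove
    filter_upwards [eventually_gt_atTop K] with k hk
    exact nonempty_iff_ne_empty.2 fun h => not_lt.2 (hK h) hk
  have hex : ∀ k : ℕ, ∃ u : EuclideanSpace ℝ (Fin n), ‖u‖ ≤ 1 ∧
      ((frontier W ∩ ball (x₀ + (3 * ((k : ℝ) + 1)) • d) 1 ∩ frontier W').Nonempty →
        x₀ + (3 * ((k : ℝ) + 1)) • d + u ∈ W') := by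
    intro k
    by_cases h : (frontier W ∩ ball (x₀ + (3 * ((k : ℝ) + 1)) • d) 1 ∩ frontier W').Nonempty
    · obtain ⟨y, ⟨-, hyb⟩, hy⟩ := h
      refine ⟨y - (x₀ + (3 * ((k : ℝ) + 1)) • d), ?_, fun _ => ?_⟩
      · rw [← dist_eq_norm]; exact (mem_ball.1 hyb).le
      · rw [add_sub_cancel]; exact hW'.frontier_subset hy
    · exact ⟨0, by simp, fun h' => absurd h' h⟩
  choose u hu1 huW using hex
  have hf : Tendsto (fun k : ℕ => 3 * ((k : ℝ) + 1)) atTop atTop :=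
    (tendsto_natCast_atTop_atTop.atTop_add tendsto_const_nhds).const_mul_atTop (by norm_num)
  have hz : Tendsto (fun k : ℕ => (3 * ((k : ℝ) + 1))⁻¹ • u k) atTop (𝓝 0) := by
    refine squeeze_zero_norm (fun k => ?_) hf.inv_tendsto_atTop
    rw [norm_smul, norm_inv, Real.norm_of_nonneg (by positivity)]
    exact mul_le_of_le_one_right (by positivity) (hu1 k)
  have hg : Tendsto (fun k : ℕ => d + (3 * ((k : ℝ) + 1))⁻¹ • u k) atTop (𝓝 d) := by
    simpa using hz.const_add d
  have ht := (hf.atTop_smul_nhds_tendsto_asymptoticNhds hg).asymptoticNhds_vadd_const x₀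
  refine ht.frequently (Eventually.frequently ?_)
  filter_upwards [hev] with k hk
  have := huW k hk
  have hk0 : (3 * ((k : ℝ) + 1)) ≠ 0 := by positivity
  rwa [smul_add, smul_inv_smul₀ hk0, vadd_eq_add, add_comm, ← add_assoc]

/-- If `C` misses a ball around `x₀`, its invariance makes it miss every translate, which is
infinitely many patches. -/
theorem IsConvexBodyUnbdd.frontier_subset_of_measure_ne_top (hW : IsConvexBodyUnbdd W)
    (hd1 : ‖d‖ = 1) (hd : d ∈ asymptoticCone ℝ W) (hd' : -d ∈ asymptoticCone ℝ W)
    (hC : IsClosed C) (hCd : ∀ x ∈ C, ∀ t : ℝ, x + t • d ∈ C)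
    (hfin : μHE[n - 1] (frontier W \ C) ≠ ⊤) : frontier W ⊆ C := by
  intro x₀ hx₀
  by_contra hx₀C
  obtain ⟨δ, hδ, hb⟩ := Metric.isOpen_iff.1 hC.isOpen_compl x₀ hx₀C
  have hf := hW.finite_setOf_inter_eq_empty hd1 hd hd' hx₀ (lt_min hδ one_pos) (min_le_right _ _)
    hC hfin
  refine infinite_univ (hf.subset fun k _ => ?_)
  change _ = ∅
  rw [eq_empty_iff_forall_notMem]
  rintro y ⟨⟨-, hyb⟩, hyC⟩
  have hmem : y + (-(3 * ((k : ℝ) + 1))) • d ∈ ball x₀ δ := by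
    rw [mem_ball, dist_eq_norm] at hyb ⊢
    have e : y + (-(3 * ((k : ℝ) + 1))) • d - x₀ = y - (x₀ + (3 * ((k : ℝ) + 1)) • d) := by
      rw [neg_smul]; abel
    rw [e]
    exact hyb.trans_le (min_le_left _ _)
  exact hb hmem (hCd y hyC _)

/-- Cylindrical convex hypersurfaces are determined up to sets of finite measure. -/
theorem IsConvexBodyUnbdd.frontier_eq_of_measure_symmDiff_ne_top (hW : IsConvexBodyUnbdd W)
    (hW' : IsConvexBodyUnbdd W') (hline : ContainsLine (frontier W))
    (hfin : μHE[n - 1] (frontier W ∆ frontier W') ≠ ⊤) : frontier W = frontier W' := by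
  obtain ⟨p, d, hd1, hp⟩ := hline.exists_direction
  obtain ⟨hd, hd'⟩ := mem_asymptoticCone_of_forall_mem (W := W)
    fun t => hW.isClosed.frontier_subset (hp t)
  have hfin1 : μHE[n - 1] (frontier W \ frontier W') ≠ ⊤ :=
    ne_top_of_le_ne_top hfin (measure_mono subset_union_left)
  have hfin2 : μHE[n - 1] (frontier W' \ frontier W) ≠ ⊤ :=
    ne_top_of_le_ne_top hfin (measure_mono subset_union_right)
  have hne : (frontier W).Nonempty := ⟨_, hp 0⟩
  have he := hW.mem_asymptoticCone_of_measure_ne_top hd1 hd hd' hne hW'.isClosed hfin1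
  have he' := hW.mem_asymptoticCone_of_measure_ne_top (d := -d) (by rwa [norm_neg]) hd'
    (by rwa [neg_neg]) hne hW'.isClosed hfin1
  exact Subset.antisymm
    (hW.frontier_subset_of_measure_ne_top hd1 hd hd' isClosed_frontier
      (fun x hx t => hW'.add_smul_mem_frontier he he' hx t) hfin1)
    (hW'.frontier_subset_of_measure_ne_top hd1 he he' isClosed_frontier
      (fun x hx t => hW.add_smul_mem_frontier hd hd' hx t) hfin2)

end Lines

/-! ### Choice of radii and the approximation theorem. -/

section Approximation

open scoped Pointwise

variable {n : ℕ} {W : Set (EuclideanSpace ℝ (Fin n))}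

/-- The set is a closed set of centres plus a compact ball. Closedness supplies the measurability
for continuity from above in `exists_radius`. -/
theorem isClosed_setOf_touchedByBall (hcl : IsClosed W) {r : ℝ} (hr : 0 ≤ r) :
    IsClosed {x | TouchedByBall W r x} := by
  have h1 : IsClosed {c | closedBall c r ⊆ W} := by
    have : {c | closedBall c r ⊆ W}
        = ⋂ w ∈ closedBall (0 : EuclideanSpace ℝ (Fin n)) 1, {c | c + r • w ∈ W} := by
      ext c
      simp only [mem_iInter, mem_closedBall_zero_iff]
      exact closedBall_subset_iff hr
    rw [this]
    exact isClosed_biInter fun w _ => hcl.preimage (continuous_id.add continuous_const)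
  have h2 : {x | TouchedByBall W r x}
      = {c | closedBall c r ⊆ W} + closedBall (0 : EuclideanSpace ℝ (Fin n)) r := by
    ext x
    constructor
    · rintro ⟨c, hc, hx⟩
      refine ⟨c, hc, x - c, ?_, by simp⟩
      rwa [mem_closedBall_zero_iff, ← dist_eq_norm]
    · rintro ⟨c, hc, w, hw, rfl⟩
      refine ⟨c, hc, ?_⟩
      rw [mem_closedBall, dist_eq_norm, add_sub_cancel_left]
      exact mem_closedBall_zero_iff.1 hw
  rw [h2]
  exact h1.add_right_of_isCompact (isCompact_closedBall 0 r)

/-- In a compact region, most frontier points of a convex body are touched by balls of a fixed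
radius. -/
theorem IsConvexBodyUnbdd.exists_radius (hW : IsConvexBodyUnbdd W)
    {A : Set (EuclideanSpace ℝ (Fin n))} (hA : MeasurableSet A) (hAW : A ⊆ frontier W)
    (hAb : Bornology.IsBounded A) {ε : ENNReal} (hε : 0 < ε) :
    ∃ s : ℝ, 0 < s ∧ s ≤ 1 ∧ μHE[n - 1] {x ∈ A | ¬ TouchedByBall W s x} < ε := by
  set B : ℕ → Set (EuclideanSpace ℝ (Fin n)) :=
    fun m => A \ {x | TouchedByBall W (1 / ((m : ℝ) + 1)) x} with hB
  have hmeas : ∀ m, NullMeasurableSet (B m) μHE[n - 1] := fun m =>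
    (hA.diff (isClosed_setOf_touchedByBall hW.isClosed (by positivity)).measurableSet
      ).nullMeasurableSet
  have hanti : Antitone B := by
    intro j k hjk x hx
    refine ⟨hx.1, fun ht => hx.2 (TouchedByBall.mono ht (by positivity) ?_)⟩
    exact one_div_le_one_div_of_le (by positivity) (by exact_mod_cast Nat.add_le_add_right hjk 1)
  have hfin : ∃ m, μHE[n - 1] (B m) ≠ ⊤ := by
    refine ⟨0, ((measure_mono fun x hx => ?_).trans_lt
      (hW.measure_frontier_inter_lt_top hAb.isCompact_closure)).ne⟩
    exact ⟨hAW hx.1, subset_closure hx.1⟩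
  have hzero : μHE[n - 1] (⋂ m, B m) = 0 := by
    refine measure_mono_null (fun x hx => ?_) hW.measure_not_touchedByBall
    rw [mem_iInter] at hx
    refine ⟨hAW (hx 0).1, ?_⟩
    rintro ⟨ρ, hρ, ht⟩
    obtain ⟨m, hm⟩ := exists_nat_one_div_lt hρ
    exact (hx m).2 (ht.mono (by positivity) hm.le)
  have hlim := tendsto_measure_iInter_atTop hmeas hanti hfin
  rw [hzero] at hlim
  obtain ⟨m, hm⟩ := (hlim.eventually (gt_mem_nhds hε)).exists
  refine ⟨1 / ((m : ℝ) + 1), by positivity, ?_, hm⟩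
  rw [div_le_one (by positivity)]
  linarith [(Nat.cast_nonneg m : (0 : ℝ) ≤ m)]

/-- Inner `C^{1,1}_loc` approximation of line-free convex bodies. -/
theorem IsConvexBodyUnbdd.exists_c11_approximation (hW : IsConvexBodyUnbdd W)
    (hline : ¬ ContainsLine W) {ε : ℝ} (hε : 0 < ε) :
    ∃ W' : Set (EuclideanSpace ℝ (Fin n)),
      IsConvexBodyUnbdd W' ∧ W' ⊆ W ∧ IsC11LocHypersurface (frontier W') ∧
        μHE[n - 1] (frontier W ∆ frontier W') < ENNReal.ofReal ε := by
  obtain ⟨z, hz⟩ := hW.interior_nonempty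
  obtain ⟨r₀, hr₀, hball⟩ := nhds_basis_closedBall.mem_iff.1 (mem_interior_iff_mem_nhds.1 hz)
  have hpt : ∀ d ∈ asymptoticCone ℝ W, -d ∈ asymptoticCone ℝ W → d = 0 := by
    intro d hd hd'
    by_contra hd0
    exact hline (containsLine_of_forall_mem hd0
      fun t => hW.add_smul_mem hd hd' (interior_subset hz) t)
  obtain ⟨v, β, hv, hnonneg, hbdd⟩ := exists_height hW.convex hW.isClosed hpt
  set ℓ : EuclideanSpace ℝ (Fin n) → ℝ := fun x => ⟪v, x⟫_ℝ + β with hℓ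
  have hℓc : Continuous ℓ := by fun_prop
  have hε4 : ENNReal.ofReal (ε / 4) ≠ 0 := by
    rw [Ne, ENNReal.ofReal_eq_zero, not_le]; positivity
  obtain ⟨η, hη, hηsum⟩ := ENNReal.exists_pos_sum_of_countable' hε4 ℕ
  have hs : ∀ k : ℕ, ∃ s : ℝ, 0 < s ∧ s ≤ 1 ∧
      μHE[n - 1] {x ∈ frontier W ∩ ℓ ⁻¹' Ico (k : ℝ) (k + 1) | ¬ TouchedByBall W s x} < η k := by
    intro k
    refine hW.exists_radius (isClosed_frontier.measurableSet.inter
      (hℓc.measurable measurableSet_Ico)) inter_subset_left ?_ (hη k)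
    refine (hbdd (k + 1)).subset fun x hx => ⟨hW.isClosed.frontier_subset hx.1, ?_⟩
    exact hx.2.2.le
  choose s hs0 hs1 hsμ using hs
  -- Products make the radii decreasing while keeping `r k ≤ s k` and `r 0 ≤ r₀`.
  set r : ℕ → ℝ := fun k => min r₀ 1 * ∏ j ∈ Finset.range (k + 1), s j with hr
  have hrpos : ∀ k, 0 < r k := fun k =>
    mul_pos (lt_min hr₀ one_pos) (Finset.prod_pos fun j _ => hs0 j)
  have hranti : Antitone r := by
    refine antitone_nat_of_succ_le fun k => ?_
    simp only [hr]
    rw [Finset.prod_range_succ _ (k + 1), ← mul_assoc]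
    exact mul_le_of_le_one_right (hrpos k).le (hs1 _)
  have hprod : ∀ k, ∏ j ∈ Finset.range k, s j ≤ 1 := fun k =>
    Finset.prod_le_one (fun j _ => (hs0 j).le) fun j _ => hs1 j
  have hrs : ∀ k, r k ≤ s k := by
    intro k
    simp only [hr]
    rw [Finset.prod_range_succ, ← mul_assoc]
    refine mul_le_of_le_one_left (hs0 k).le ?_
    exact mul_le_one₀ (min_le_right _ _) (Finset.prod_nonneg fun j _ => (hs0 j).le) (hprod k)
  have hr0 : r 0 ≤ r₀ := by
    simp only [hr]
    exact (mul_le_of_le_one_right (lt_min hr₀ one_pos).le (hprod 1)).trans (min_le_left _ _)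
  -- With this weight the `T`-th constraint asks for at most `r T` at nonnegative heights.
  set a : ℕ → ℝ := fun T => r T / (T + 1) with ha
  have hapos : ∀ T, 0 < a T := fun T => div_pos (hrpos T) (by positivity)
  have haT : ∀ (T : ℕ) (y : ℝ), 0 ≤ y → a T * (T - y) ≤ r T := by
    intro T y hy
    simp only [ha]
    rw [div_mul_eq_mul_div, div_le_iff₀ (by positivity)]
    exact mul_le_mul_of_nonneg_left (by linarith) (hrpos T).le
  set W' := roundedBody W v β a (r 0) with hW'def
  have hsub : W' ⊆ W := roundedBody_subset
  have hW' : IsConvexBodyUnbdd W' := by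
    refine ⟨isClosed_roundedBody hW.isClosed, convex_roundedBody hW.convex, z, ?_⟩
    rw [mem_interior_iff_mem_nhds]
    refine mem_of_superset (closedBall_mem_nhds z (hrpos 0)) fun p hp => ?_
    refine ⟨z, r 0, (hrpos 0).le, le_rfl, fun T => ?_,
      (closedBall_subset_closedBall hr0).trans hball, hp⟩
    exact (haT T _ (hnonneg z (interior_subset hz))).trans (hranti (Nat.zero_le T))
  have htouch : ∀ (k : ℕ), ∀ x ∈ frontier W, (k : ℝ) ≤ ℓ x → TouchedByBall W (s k) x →
      x ∈ frontier W' := by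
    intro k x hx hk ht
    have hxW' : x ∈ W' := by
      obtain ⟨c, hc, hxc⟩ := ht.mono (hrpos k).le (hrs k)
      refine ⟨c, r k, (hrpos k).le, hranti (Nat.zero_le k), fun T => ?_, hc, hxc⟩
      have hcW : 0 ≤ ⟪v, c⟫_ℝ + β := hnonneg c (hc (mem_closedBall_self (hrpos k).le))
      -- For `T ≥ k` the constraint is at most `r T ≤ r k`. For `T < k` the centre has height at
      -- least `k - 1 ≥ T`, so the constraint is nonpositive.
      rcases le_or_gt k T with hkT | hTk
      · exact (haT T _ hcW).trans (hranti hkT)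
      · refine (mul_nonpos_of_nonneg_of_nonpos (hapos T).le ?_).trans (hrpos k).le
        have h1 : (T : ℝ) + 1 ≤ k := by exact_mod_cast hTk
        rw [mem_closedBall, dist_eq_norm] at hxc
        have h2 : ⟪v, x - c⟫_ℝ ≤ 1 * 1 :=
          (real_inner_le_norm v (x - c)).trans (by gcongr; exact hxc.trans ((hrs k).trans (hs1 k)))
        rw [inner_sub_right] at h2
        have h3 : (k : ℝ) ≤ ⟪v, x⟫_ℝ + β := hk
        linarith
    exact ⟨subset_closure hxW', fun hi => hx.2 (interior_mono hsub hi)⟩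
  have hlost : μHE[n - 1] (frontier W \ frontier W') ≤ ENNReal.ofReal (ε / 4) := by
    have hcover : frontier W \ frontier W' ⊆
        ⋃ k : ℕ, {x ∈ frontier W ∩ ℓ ⁻¹' Ico (k : ℝ) (k + 1) | ¬ TouchedByBall W (s k) x} := by
      rintro x ⟨hx, hxn⟩
      have hℓx : 0 ≤ ℓ x := hnonneg x (hW.isClosed.frontier_subset hx)
      refine mem_iUnion.2 ⟨⌊ℓ x⌋₊, ⟨hx, Nat.floor_le hℓx, Nat.lt_floor_add_one _⟩, fun ht => ?_⟩
      exact hxn (htouch _ x hx (Nat.floor_le hℓx) ht)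
    refine (measure_mono hcover).trans ((measure_iUnion_le _).trans ?_)
    exact (ENNReal.tsum_le_tsum fun k => (hsμ k).le).trans hηsum.le
  have hnew : μHE[n - 1] (frontier W' \ frontier W) ≤ μHE[n - 1] (frontier W \ frontier W') := by
    refine measure_frontier_diff_le hW.isClosed hW' hsub fun d hd x hx => ?_
    refine add_mem_roundedBody (fun T => (hapos T).le) (fun y hy => ?_) ?_ hx
    · have := add_smul_mem_of_mem_asymptoticCone hW.convex hW.isClosed hd hy zero_le_one
      rwa [one_smul] at this
    · by_contra! hneg
      -- If `⟪v, d⟫ < 0`, moving this far from `z` along `d` would reach height `-1` inside `W`.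
      have hpos : 0 ≤ (ℓ z + 1) / (-⟪v, d⟫_ℝ) :=
        div_nonneg (by linarith [hnonneg z (interior_subset hz)]) (by linarith)
      have := hnonneg _ (add_smul_mem_of_mem_asymptoticCone hW.convex hW.isClosed hd
        (interior_subset hz) hpos)
      rw [inner_add_right, inner_smul_right] at this
      have h1 : (ℓ z + 1) / (-⟪v, d⟫_ℝ) * ⟪v, d⟫_ℝ = -(ℓ z + 1) := by
        rw [div_mul_eq_mul_div, div_eq_iff (by linarith)]; ring
      rw [h1] at this
      simp only [hℓ] at this
      linarith
  refine ⟨W', hW', hsub, isC11LocHypersurface_frontier hW' fun x₀ _ => ?_, ?_⟩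
  · obtain ⟨ρ, hρ, hev⟩ := roundedBody_touchedByBall (W := W) (β := β) (R := r 0) hv hapos x₀
    exact ⟨ρ, hρ, hev.mono fun x hx hxf => hx (hW'.isClosed.frontier_subset hxf)⟩
  · calc μHE[n - 1] (frontier W ∆ frontier W')
        ≤ μHE[n - 1] (frontier W \ frontier W') + μHE[n - 1] (frontier W' \ frontier W) :=
          measure_union_le _ _
      _ ≤ ENNReal.ofReal (ε / 4) + ENNReal.ofReal (ε / 4) := add_le_add hlost (hnew.trans hlost)
      _ = ENNReal.ofReal (ε / 2) := by
          rw [← ENNReal.ofReal_add (by positivity) (by positivity)]; congr 1; ring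
      _ < ENNReal.ofReal ε := (ENNReal.ofReal_lt_ofReal_iff hε).2 (by linarith)

end Approximation

theorem theorem1p6 (n : ℕ) (hn : 1 ≤ n) :
    (∀ S : Set (EuclideanSpace ℝ (Fin n)),
      IsConvexHypersurface S → ¬ IsC11LocHypersurface S →
        ((∀ ε : ℝ, 0 < ε → ∃ S' : Set (EuclideanSpace ℝ (Fin n)),
            IsConvexHypersurface S' ∧ IsC11LocHypersurface S' ∧
              Measure.euclideanHausdorffMeasure (n - 1) (S ∆ S') < ENNReal.ofReal ε) ↔
          ¬ ContainsLine S)) ∧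
    (∀ W : Set (EuclideanSpace ℝ (Fin n)),
      IsConvexBodyUnbdd W → ¬ ContainsLine W →
        ∀ ε : ℝ, 0 < ε → ∃ W' : Set (EuclideanSpace ℝ (Fin n)),
          IsConvexBodyUnbdd W' ∧ W' ⊆ W ∧ IsC11LocHypersurface (frontier W') ∧
            Measure.euclideanHausdorffMeasure (n - 1) (frontier W ∆ frontier W') <
              ENNReal.ofReal ε) := by
  refine ⟨?_, fun W hW hline ε hε => hW.exists_c11_approximation hline hε⟩
  rintro _ ⟨W, hW, rfl⟩ hS
  constructor
  · intro happ hline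
    obtain ⟨_, ⟨W', hW', rfl⟩, hC11, hlt⟩ := happ 1 one_pos
    apply hS
    rwa [hW.frontier_eq_of_measure_symmDiff_ne_top hW' hline (ne_top_of_lt hlt)]
  · intro hline ε hε
    have hlineW : ¬ ContainsLine W := by
      intro h
      obtain ⟨p, d, hd1, hp⟩ := h.exists_direction
      obtain ⟨hd, hd'⟩ := mem_asymptoticCone_of_forall_mem hp
      -- An empty frontier is vacuously `C^{1,1}_loc`, which `hS` excludes; so a line in `W` can be
      -- translated into the frontier.
      have hne : (frontier W).Nonempty := by
        by_contra hempty
        rw [not_nonempty_iff_eq_empty] at hempty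
        exact hS fun x hx => absurd hx (by rw [hempty]; exact notMem_empty x)
      obtain ⟨x₀, hx₀⟩ := hne
      have hd0 : d ≠ 0 := by rintro rfl; simp at hd1
      exact hline (containsLine_of_forall_mem hd0
        fun t => hW.add_smul_mem_frontier hd hd' hx₀ t)
    obtain ⟨W', hW', -, hC11, hlt⟩ := hW.exists_c11_approximation hlineW hε
    exact ⟨frontier W', ⟨W', hW', rfl⟩, hC11, hlt⟩
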